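/- **Definitions.** For metric spaces $X,Y$ let $c_Y(X)=\inf\{\|f\|_{\mathrm{Lip}}\|f^{-1}\|_{\mathrm{Lip}} : f:X\hookrightarrow Y\}$ and $c_p(X)=c_{L_p[0,1]}(X)$. Let $B_k$ be the complete binary tree of depth $k$ with unit edge lengths and $\mathscr B_X(c)=\max\{k\in\mathbb N: c_X(B_k)<c\}$. For $p>0$ let $\Pi_p(X)\in[0,\infty]$ be the least $\Pi$ such that for every Markov chain $(X_t)_{t\ge 0}$ on a discrete state space $\Omega$, every $f:\Omega\to X$ and every $m\in\mathbb N$, $$\sum_{k=0}^m\sum_{t=1}^{2^m}\frac{\mathbb E\big[d(f(X_t),f(\widetilde X_t(t-2^k)))^p\big]}{2^{kp}}\le \Pi^p\sum_{t=1}^{2^m}\mathbb E\big[d(f(X_t),f(X_{t-1}))^p\big],$$ where $\widetilde X_t(s)$ is the process that equals $X_t$ for $t\le \max\{s,0\}$ and afterwards evolves independently with the same transition probabilities. A rooted tree with positive edge lengths and path metric $d_T$ is an $(\varepsilon,\delta)$-weak prototype with height ratio $R$ if every non-leaf vertex has one or two children; the longest root-leaf path is at most $R$ times as long as the shortest; and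 for every root-leaf path, from $u$ to $v$, if $u_1,\dots,u_m$ are its vertices with at least two children, in order, then the consecutive distances in $(u,u_1,\dots,u_m,v)$ that are at most $\delta\, d_T(u,v)$ sum to at least $\varepsilon\, d_T(u,v)$. A spherically symmetric tree with downward degree sequence $(s_0,\dots,s_h)$, $s_h=0$, is a rooted tree in which every vertex at depth $j$ has exactly $s_j$ children. Let $S_0=(2)$, let $S_{i+1}$ be the concatenation of $S_i$, $2^i-1$ ones, and $S_i$, and let $\widetilde S_i$ be $S_i$ with its last entry replaced by $0$. The Cantor tree $C_i$ is the spherically symmetric tree with downward degree sequence $\widetilde S_i$ and unit edge lengths. **Statement.** $|C_i|\to\infty$, and the following hold. 1. For every $i\ge 2$, $C_i$ is a $(\tfrac12,2^{-i/3})$-weak prototype with height ratio $1$. 2. There is a universal $\kappa>0$ with $\Pi_p(C_i)\ge(\kappa i)^{1/p}$ for all $p\in(0,\infty)$ and all $i\ge 0$; in particular $\Pi_p(C_i)\ge\Omega(i^{1/p})$. 3. For every $c>1$ there is $K=K(c)$ with $\mathscr B_{C_i}(c)\le K i$ for all $i\ge 0$. 4. For every $p\in(1,\infty)$ and $c>1$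 there are $\kappa_1=\kappa_1(p)>0$, $\kappa_2=\kappa_2(c)>0$ and $\kappa_3=\kappa_3(p,c)>0$ such that for all $i\ge 0$, $$c_p(C_i)\ge \kappa_1\,\Pi_{\max\{2,p\}}(C_i),\qquad \Pi_{\max\{2,p\}}(C_i)\ge \kappa_2\,\mathscr B_{C_i}(c)^{\min\{1/p,1/2\}},\qquad c_p(C_i)\ge\kappa_3\,\mathscr B_{C_i}(c)^{\min\{1/p,1/2\}}.$$ 5. Consequently the upper bound $c_p(T)\le 130\left(\frac{c}{c-1}\mathscr B_T(c)\right)^{\min\{1/p,1/2\}}$, valid for all metric trees $T$, has the optimal dependence on $\mathscr B_T(c)$: for all $p\in(1,\infty)$, $c>1$ and every $g:\mathbb N\to\mathbb R$ with $g(k)=o(k^{\min\{1/p,1/2\}})$ there is an $i$ with $c_p(C_i)>g(\mathscr B_{C_i}(c))$. -/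

import Mathlib

open scoped ENNReal NNReal

noncomputable section

namespace CantorTree

/-! ### Bi-Lipschitz distortion -/

/-- The distortion `‖f‖_Lip * ‖f⁻¹‖_Lip` of an (injective) map between metric spaces, where
`f⁻¹` is defined on the range of `f`. -/
def mapDistortion {X Y : Type*} [EDist X] [EDist Y] (f : X → Y) : ℝ≥0∞ :=
  (⨆ (x : X) (y : X) (_ : x ≠ y), edist (f x) (f y) / edist x y) *
    (⨆ (x : X) (y : X) (_ : x ≠ y), edist x y / edist (f x) (f y))

/-- `distortion X Y` is `c_Y(X)`, the infimum of the distortions of all injections `X → Y`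
(it is `∞` if no injection has finite distortion). -/
def distortion (X Y : Type*) [EDist X] [EDist Y] : ℝ≥0∞ :=
  ⨅ (f : X → Y) (_ : Function.Injective f), mapDistortion f

/-- `lpDistortion p X` is `c_p(X)`, the distortion of `X` into the real space `L_p[0,1]`. -/
def lpDistortion (p : ℝ) (X : Type*) [EDist X] : ℝ≥0∞ :=
  distortion X (MeasureTheory.Lp ℝ (ENNReal.ofReal p)
    (MeasureTheory.volume.restrict (Set.Icc (0 : ℝ) 1)))

/-! ### Markov convexity

A Markov chain on a discrete state space `Ω` is given by the law `init` of `X_0` and the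
transition probabilities `step`. -/

section Markov

variable {Ω : Type}

/-- The law of `X_t`. -/
def chainLaw (init : PMF Ω) (step : Ω → PMF Ω) : ℕ → PMF Ω
  | 0 => init
  | t + 1 => (chainLaw init step t).bind step

/-- The joint law of `(X_t, X_{t+1})`. -/
def stepLaw (init : PMF Ω) (step : Ω → PMF Ω) (t : ℕ) : PMF (Ω × Ω) :=
  (chainLaw init step t).bind fun x => (step x).map fun y => (x, y)

/-- The joint law, for `s ≤ t`, of `(X_t, X̃_t(s))`: both chains agree up to time `s`, and run
independently with the same transition probabilities for the remaining `t - s` steps. -/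
def splitLaw (init : PMF Ω) (step : Ω → PMF Ω) (s t : ℕ) : PMF (Ω × Ω) :=
  (chainLaw init step s).bind fun x =>
    (chainLaw (PMF.pure x) step (t - s)).bind fun y =>
      (chainLaw (PMF.pure x) step (t - s)).map fun z => (y, z)

/-- The expectation of a `[0,∞]`-valued function. -/
def expect {α : Type*} (μ : PMF α) (g : α → ℝ≥0∞) : ℝ≥0∞ := ∑' a, μ a * g a

end Markov

/-- `X` is Markov `p`-convex with constant `C`. The subtraction `t - 2 ^ k` is truncated: for
`t < 2 ^ k` the two chains have the same starting point `X_0` and run independently from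
time `0` on. -/
def IsMarkovConvexWith (X : Type*) [EDist X] (p : ℝ) (C : ℝ≥0) : Prop :=
  ∀ (Ω : Type) (init : PMF Ω) (step : Ω → PMF Ω) (f : Ω → X) (m : ℕ),
    ∑ k ∈ Finset.range (m + 1), ∑ t ∈ Finset.Icc 1 (2 ^ m),
        expect (splitLaw init step (t - 2 ^ k) t) (fun z => edist (f z.1) (f z.2) ^ p) /
          (2 : ℝ≥0∞) ^ ((k : ℝ) * p)
      ≤ (C : ℝ≥0∞) ^ p *
        ∑ t ∈ Finset.Icc 1 (2 ^ m),
          expect (stepLaw init step (t - 1)) (fun z => edist (f z.2) (f z.1) ^ p)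

/-- The Markov `p`-convexity constant `Π_p(X)`. -/
def markovConvexity (p : ℝ) (X : Type*) [EDist X] : ℝ≥0∞ :=
  ⨅ (C : ℝ≥0) (_ : IsMarkovConvexWith X p C), (C : ℝ≥0∞)

/-! ### Weighted rooted trees and weak prototypes -/

section Prototype

variable {V : Type*}

/-- The shortest path metric induced by the edge lengths `ℓ`. -/
def pathDist (G : SimpleGraph V) (ℓ : Sym2 V → ℝ) (u v : V) : ℝ :=
  ⨅ w : G.Walk u v, (w.edges.map ℓ).sum

/-- The children of `v` in the tree `G` rooted at `r`. -/
def children (G : SimpleGraph V) (r v : V) : Set V :=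
  {w | G.Adj v w ∧ G.dist r w = G.dist r v + 1}

/-- A leaf is a vertex without children. -/
def IsLeaf (G : SimpleGraph V) (r v : V) : Prop := children G r v = ∅

/-- A path metric whose successive edges have lengths `L` is `(ε, δ)`-weak if at least an
`ε`-fraction of its length consists of edges of length at most `δ` times its length. -/
def IsWeakPath (ε δ : ℝ) (L : List ℝ) : Prop :=
  ε * L.sum ≤ (L.filter fun x => x ≤ δ * L.sum).sum

open Classical in
/-- The vertices `(u, u₁, …, u_m, v)`, where `u₁, …, u_m` are the vertices, in order, of the
path `P` from `u` to `v` which have at least two children. -/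
def branchList (G : SimpleGraph V) (r : V) {u v : V} (P : G.Walk u v) : List V :=
  u :: (P.support.filter fun x => 2 ≤ (children G r x).encard) ++ [v]

/-- The path `P` is degree-2 `(ε, δ)`-weak. -/
def IsDegreeTwoWeak (G : SimpleGraph V) (r : V) (ℓ : Sym2 V → ℝ) (ε δ : ℝ) {u v : V}
    (P : G.Walk u v) : Prop :=
  IsWeakPath ε δ
    (List.zipWith (pathDist G ℓ) (branchList G r P) (branchList G r P).tail)

/-- The graph `G` with root `r` and edge lengths `ℓ` is a tree which is an `(ε, δ)`-weak
prototype with height ratio `R`. -/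
structure IsWeakPrototype (G : SimpleGraph V) (r : V) (ℓ : Sym2 V → ℝ) (ε δ R : ℝ) : Prop where
  isTree : G.IsTree
  length_pos : ∀ e ∈ G.edgeSet, 0 < ℓ e
  one_or_two_children : ∀ v, ¬ IsLeaf G r v →
    (children G r v).encard = 1 ∨ (children G r v).encard = 2
  root_leaf_weak : ∀ (v : V) (P : G.Walk r v), IsLeaf G r v → P.IsPath →
    IsDegreeTwoWeak G r ℓ ε δ P
  height_ratio : ∀ v w, IsLeaf G r v → IsLeaf G r w → pathDist G ℓ r v ≤ R * pathDist G ℓ r w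

end Prototype

/-! ### Spherically symmetric trees -/

/-- The vertices of the spherically symmetric tree with downward degree sequence `s` (which ends
in `0`). A vertex is the list of choices of children on the way to it from the root `[]`; a
vertex at depth `j` has `s_j` children. -/
def SST (s : List ℕ) : Type :=
  {l : List ℕ // ∀ (j : ℕ) (h : j < l.length), l[j] < s.getD j 0}

namespace SST

variable {s : List ℕ}

/-- The root. -/
def root (s : List ℕ) : SST s := ⟨[], fun j h => absurd h (Nat.not_lt_zero j)⟩

/-- The tree as a graph: the edges join a vertex to its children. -/
def graph (s : List ℕ) : SimpleGraph (SST s) where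
  Adj u v := (∃ a, v.1 = u.1 ++ [a]) ∨ (∃ a, u.1 = v.1 ++ [a])
  symm := ⟨fun _ _ h => h.symm⟩
  loopless := ⟨fun u h => by
    rcases h with ⟨a, h⟩ | ⟨a, h⟩ <;> simpa using congrArg List.length h⟩

theorem reachable_root (l : List ℕ) (hl : ∀ (j : ℕ) (h : j < l.length), l[j] < s.getD j 0) :
    (graph s).Reachable (root s) ⟨l, hl⟩ := by
  induction l using List.reverseRecOn with
  | nil => exact SimpleGraph.Reachable.refl _
  | append_singleton l a ih =>
    have hl' : ∀ (j : ℕ) (h : j < l.length), l[j] < s.getD j 0 := fun j h => by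
      have := hl j (by simp; omega)
      rwa [List.getElem_append_left h] at this
    refine (ih hl').trans (SimpleGraph.Adj.reachable ?_)
    exact Or.inl ⟨a, rfl⟩

theorem connected (s : List ℕ) : (graph s).Connected :=
  { preconnected := fun u v => (reachable_root u.1 u.2).symm.trans (reachable_root v.1 v.2)
    nonempty := ⟨root s⟩ }

/-- The shortest path metric with unit edge lengths. -/
instance : MetricSpace (SST s) where
  dist u v := ((graph s).dist u v : ℝ)
  dist_self u := by simp
  dist_comm u v := by rw [SimpleGraph.dist_comm]
  dist_triangle u v w := by exact_mod_cast (connected s).dist_triangle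
  eq_of_dist_eq_zero {u v} h := (connected s).dist_eq_zero_iff.1 (by exact_mod_cast h)

end SST

/-- The complete binary tree `B_k` of depth `k`, with unit edge lengths. -/
abbrev BinaryTree (k : ℕ) : Type := SST (List.replicate k 2 ++ [0])

/-- `binaryDepth X c` is `𝓑_X(c)`, the largest `k` such that `c_X(B_k) < c` (`∞` if there are
arbitrarily large such `k`). -/
def binaryDepth (X : Type*) [EDist X] (c : ℝ) : ℕ∞ :=
  ⨆ (k : ℕ) (_ : distortion (BinaryTree k) X < ENNReal.ofReal c), (k : ℕ∞)

/-! ### Cantor trees -/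

/-- The sequences `S_i`. -/
def cantorSeq : ℕ → List ℕ
  | 0 => [2]
  | i + 1 => cantorSeq i ++ List.replicate (2 ^ i - 1) 1 ++ cantorSeq i

/-- `S_i` with its last element replaced by `0`. -/
def cantorDegrees (i : ℕ) : List ℕ := (cantorSeq i).dropLast ++ [0]

/-- The Cantor tree `C_i`, with unit edge lengths. -/
abbrev Cantor (i : ℕ) : Type := SST (cantorDegrees i)

end CantorTree

end

/-! In `S_i` two consecutive branching levels are at distance `2 ^ k` exactly `2 ^ (i - 1 - k)`
times, for each `k < i`, so that every dyadic scale fills the same share `2 ^ (i - 1)` of the height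
`i * 2 ^ (i - 1)`. In particular gaps much shorter than the height make up half of every root-leaf
path.

For the lower bound on the Markov convexity constant, descend from the root to a uniformly random
child at each step. For a positive fraction of the pairs `(k, t)` with `k < i` there is a
branching level between `t - 2 ^ (k + 1)` and `t - 2 ^ k`. Restarted at time `t - 2 ^ (k + 1)`,
the walk takes another branch there with probability at least `1 / 2`, and is then at distance at
least `2 ^ (k + 1)` from the original one at time `t`. Each of the `i` scales thus contributes on
average a constant multiple of the number of steps.

In `L_p`, uniform convexity with power type `q = max 2 p` gives a four-point inequality for forks
`x → y → {z, w}`. Applied to a Markov chain at the times `t - 2 ^ (k + 1)`, `t - 2 ^ k`, `t` and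
its restart, and divided by `2 ^ (k * q)`, it telescopes over `k`, so that `L_p` is Markov
`q`-convex; hence `c_p(X)` is bounded below by a multiple of the constant of `X`.

Between any two branching levels far enough apart, `C_i` is locally a segment, into which a ball
of `2 ^ q` points of a binary tree does not fit with bounded distortion. Such stretches occur in
every window of length comparable to `i` times the Lipschitz constant of the embedding, and the
image of a binary tree cannot branch off below one. Hence the image has a diameter of this order,
which bounds the depth of the binary tree by a multiple of `i`. As `c_p(C_i)` is at least of order
`i ^ min (1 / p) (1 / 2)`, no bound by a function of the depth of smaller order is possible.
-/

noncomputable section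

namespace CantorTree

/-! ### The metric of a spherically symmetric tree -/

/-- The tree distance of two vertices, given as words: the number of letters after their longest
common prefix. -/
def wordDist : List ℕ → List ℕ → ℕ
  | [], l => l.length
  | _ :: l, [] => l.length + 1
  | a :: l, b :: l' => if a = b then wordDist l l' else l.length + l'.length + 2

@[simp]
theorem wordDist_self (l : List ℕ) : wordDist l l = 0 := by
  induction l <;> simp_all [wordDist]

@[simp]
theorem wordDist_nil_left (l : List ℕ) : wordDist [] l = l.length := by
  simp [wordDist]

@[simp]
theorem wordDist_append_append (w x y : List ℕ) :
    wordDist (w ++ x) (w ++ y) = wordDist x y := by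
  induction w <;> simp_all [wordDist]

theorem wordDist_of_isPrefix {l l' : List ℕ} (h : l <+: l') :
    wordDist l l' = l'.length - l.length := by
  obtain ⟨x, rfl⟩ := h
  simpa using wordDist_append_append l [] x

theorem wordDist_concat_left (l l' : List ℕ) (a : ℕ) :
    wordDist (l ++ [a]) l' = wordDist l l' + 1 ∨ wordDist l l' = wordDist (l ++ [a]) l' + 1 := by
  fun_induction wordDist l l' with
  | case1 l' => cases l' <;> grind [wordDist]
  | case2 | case3 | case4 => grind [wordDist]

theorem exists_wordDist_eq (l l' : List ℕ) : ∃ w x y, l = w ++ x ∧ l' = w ++ y ∧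
    wordDist l l' = x.length + y.length := by
  fun_induction wordDist l l' with
  | case1 l' => exact ⟨[], [], l', by simp⟩
  | case2 b l => exact ⟨[], b :: l, [], by simp⟩
  | case3 l a l' ih =>
    obtain ⟨w, x, y, rfl, rfl, hd⟩ := ih
    exact ⟨a :: w, x, y, rfl, rfl, hd⟩
  | case4 a l b l' => exact ⟨[], a :: l, b :: l', rfl, rfl, by simp; omega⟩

theorem le_wordDist_of_getElem?_ne {l l' : List ℕ} {a : ℕ} (h : l[a]? ≠ l'[a]?) :
    l.length + l'.length ≤ wordDist l l' + 2 * a := by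
  obtain ⟨w, x, y, rfl, rfl, hd⟩ := exists_wordDist_eq l l'
  have hw : w.length ≤ a := by
    by_contra! hlt
    simp [List.getElem?_append_left hlt] at h
  simp only [List.length_append]
  omega

namespace SST

variable {s : List ℕ}

/-- The ancestor of a vertex at depth `n`, or the vertex itself if its depth is less than `n`. -/
def take (v : SST s) (n : ℕ) : SST s :=
  ⟨v.1.take n, fun j h => by
    simpa using v.2 j (h.trans_le (List.length_take_le' n v.1))⟩

@[simp]
theorem val_take (v : SST s) (n : ℕ) : (v.take n).1 = v.1.take n := rfl

/-- The child of a vertex reached by the choice `a`. -/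
def snoc (v : SST s) (a : ℕ) (h : a < s.getD v.1.length 0) : SST s :=
  ⟨v.1 ++ [a], fun j hj => by
    obtain hlt | rfl : j < v.1.length ∨ j = v.1.length := by simp at hj; omega
    · simpa [List.getElem_append_left hlt] using v.2 j hlt
    · simpa using h⟩

@[simp]
theorem val_snoc (v : SST s) (a : ℕ) (h : a < s.getD v.1.length 0) :
    (v.snoc a h).1 = v.1 ++ [a] := rfl

theorem lt_of_val_eq_append {u v : SST s} {a : ℕ} (h : v.1 = u.1 ++ [a]) :
    a < s.getD u.1.length 0 := by
  simpa [h] using v.2 u.1.length (by simp [h])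

@[simp]
theorem take_length (v : SST s) : v.take v.1.length = v := Subtype.ext (by simp)

theorem adj_take_take (v : SST s) {n : ℕ} (hn : n < v.1.length) :
    (graph s).Adj (v.take n) (v.take (n + 1)) :=
  Or.inl ⟨v.1[n], (List.take_append_getElem hn).symm⟩

theorem ne_of_val_eq_append {u v : SST s} {a : ℕ} (h : v.1 = u.1 ++ [a]) : u ≠ v := by
  rintro rfl
  simp at h

theorem wordDist_le_length (u v : SST s) (p : (graph s).Walk u v) :
    wordDist u.1 v.1 ≤ p.length := by
  induction p with
  | nil => simp
  | @cons x y z hxy p ih =>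
    rw [SimpleGraph.Walk.length_cons]
    obtain ⟨a, ha⟩ | ⟨a, ha⟩ := hxy
    · have := wordDist_concat_left x.1 z.1 a
      grind
    · have := wordDist_concat_left y.1 z.1 a
      grind

theorem dist_take_take_le (v : SST s) {n m : ℕ} (hnm : n ≤ m) (hm : m ≤ v.1.length) :
    (graph s).dist (v.take n) (v.take m) ≤ m - n := by
  induction m, hnm using Nat.le_induction with
  | base => simp
  | succ m hnm ih =>
    have hstep : (graph s).dist (v.take m) (v.take (m + 1)) = 1 :=
      SimpleGraph.dist_eq_one_iff_adj.2 (v.adj_take_take hm)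
    have := (connected s).dist_triangle (u := v.take n) (v := v.take m) (w := v.take (m + 1))
    have := ih (by omega)
    omega

theorem graph_dist_eq (u v : SST s) : (graph s).dist u v = wordDist u.1 v.1 := by
  refine le_antisymm ?_ ?_
  · obtain ⟨w, x, y, hu, hv, hd⟩ := exists_wordDist_eq u.1 v.1
    have hmeet : u.take w.length = v.take w.length := Subtype.ext (by simp [hu, hv])
    have hux := u.dist_take_take_le (n := w.length) (by simp [hu]) le_rfl
    have hvy := v.dist_take_take_le (n := w.length) (by simp [hv]) le_rfl
    rw [take_length, hmeet, SimpleGraph.dist_comm] at hux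
    rw [take_length] at hvy
    have htri := (connected s).dist_triangle (u := u) (v := v.take w.length) (w := v)
    simp only [hu, hv, List.length_append] at hux hvy
    omega
  · obtain ⟨p, hp⟩ := (connected s).exists_walk_length_eq_dist u v
    exact hp ▸ wordDist_le_length u v p

theorem dist_eq (u v : SST s) : dist u v = wordDist u.1 v.1 := by
  rw [← graph_dist_eq]; rfl

theorem edist_eq (u v : SST s) : edist u v = (wordDist u.1 v.1 : ℝ≥0∞) := by
  rw [edist_dist, dist_eq, ENNReal.ofReal_natCast]

theorem graph_dist_root (v : SST s) : (graph s).dist (root s) v = v.1.length := by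
  rw [graph_dist_eq]
  exact wordDist_nil_left _

theorem length_le (v : SST s) : v.1.length ≤ s.length := by
  by_contra! h
  simpa using v.2 s.length h

instance : Finite (SST s) := by
  have hbound (v : SST s) : ∀ a ∈ v.1, a < s.sum + 1 := by
    intro a ha
    obtain ⟨j, hj, rfl⟩ := List.getElem_of_mem ha
    have hjs : j < s.length := hj.trans_le v.length_le
    have := List.le_sum_of_mem (List.getElem_mem hjs)
    have := v.2 j hj
    rw [List.getD_eq_getElem _ _ hjs] at this
    omega
  refine Set.Finite.to_subtype <|
    ((List.finite_length_le (Fin (s.sum + 1)) s.length).image (List.map Fin.val)).subset ?_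
  intro l hl
  lift l to List (Fin (s.sum + 1)) using hbound ⟨l, hl⟩ with l'
  exact ⟨l', by simpa using length_le ⟨_, hl⟩, rfl⟩

theorem eq_of_adj_of_isPrefix {v x y : SST s} (hxy : (graph s).Adj x y) (hx : ¬ v.1 <+: x.1)
    (hy : v.1 <+: y.1) : y = v ∧ ∃ a, v.1 = x.1 ++ [a] := by
  obtain ⟨a, ha⟩ | ⟨a, ha⟩ := hxy
  · rw [ha, List.prefix_concat_iff] at hy
    have hv := hy.resolve_right hx
    exact ⟨Subtype.ext (ha.trans hv.symm), a, hv⟩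
  · exact absurd (hy.trans (ha ▸ List.prefix_append _ _)) hx

theorem isBridge_of_val_eq_append {u v : SST s} {a : ℕ} (h : v.1 = u.1 ++ [a]) :
    (graph s).IsBridge s(u, v) := by
  rw [SimpleGraph.isBridge_iff]
  rintro ⟨p⟩
  obtain ⟨d, -, hfst, hsnd⟩ := p.exists_boundary_dart {x | ¬ v.1 <+: x.1}
    (fun hp => by simpa [h] using hp.length_le) (not_not.2 List.prefix_rfl)
  obtain ⟨hadj, hne⟩ := d.adj
  obtain ⟨hv, b, hb⟩ := eq_of_adj_of_isPrefix hadj hfst (not_not.1 hsnd)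
  have hu : d.fst = u := Subtype.ext (List.append_inj' (hb.symm.trans h) rfl).1
  simp [hu, hv, ne_of_val_eq_append h] at hne

theorem isTree : (graph s).IsTree := by
  refine ⟨connected s, SimpleGraph.isAcyclic_iff_forall_adj_isBridge.2 ?_⟩
  rintro u v (⟨a, h⟩ | ⟨a, h⟩)
  · exact isBridge_of_val_eq_append h
  · exact Sym2.eq_swap ▸ isBridge_of_val_eq_append h

theorem mem_children {v w : SST s} :
    w ∈ children (graph s) (root s) v ↔ ∃ a, w.1 = v.1 ++ [a] := by
  simp only [children, Set.mem_ofPred_eq, graph_dist_root]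
  constructor
  · rintro ⟨⟨a, h⟩ | ⟨a, h⟩, hlen⟩
    · exact ⟨a, h⟩
    · simp [h] at hlen
      omega
  · rintro ⟨a, h⟩
    exact ⟨Or.inl ⟨a, h⟩, by simp [h]⟩

theorem children_eq_range (v : SST s) :
    children (graph s) (root s) v =
      Set.range fun a : Fin (s.getD v.1.length 0) => v.snoc a a.2 := by
  ext w
  rw [mem_children]
  exact ⟨fun ⟨a, h⟩ => ⟨⟨a, lt_of_val_eq_append h⟩, Subtype.ext h.symm⟩,
    fun ⟨a, h⟩ => ⟨a, congrArg Subtype.val h.symm⟩⟩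

theorem encard_children (v : SST s) :
    (children (graph s) (root s) v).encard = (s.getD v.1.length 0 : ℕ) := by
  have hinj : Function.Injective fun a : Fin (s.getD v.1.length 0) => v.snoc a a.2 :=
    fun a b h => by simpa [Fin.ext_iff] using congrArg Subtype.val h
  rw [children_eq_range, ← Set.image_univ, hinj.encard_image, Set.encard_univ]
  simp

theorem isLeaf_iff (v : SST s) : IsLeaf (graph s) (root s) v ↔ s.getD v.1.length 0 = 0 := by
  rw [IsLeaf, ← Set.encard_eq_zero, encard_children]
  simp

end SST

/-! ### Degree sequences of given height -/

/-- The sequence `s` is the downward degree sequence of a tree all of whose leaves have depth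
`h`. -/
def HasHeight (s : List ℕ) (h : ℕ) : Prop := ∀ j, 0 < s.getD j 0 ↔ j < h

/-- The vertices at depth `a` have at least two children. -/
def IsBranchLevel (s : List ℕ) (a : ℕ) : Prop := 2 ≤ s.getD a 0

theorem IsBranchLevel.lt {s : List ℕ} {h a : ℕ} (hs : HasHeight s h) (ha : IsBranchLevel s a) :
    a < h :=
  (hs a).1 (two_pos.trans_le ha)

namespace SST

variable {s : List ℕ} {h : ℕ}

theorem length_le_of_hasHeight (hs : HasHeight s h) (v : SST s) : v.1.length ≤ h := by
  by_contra! hlt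
  exact lt_irrefl h ((hs h).1 ((Nat.zero_le _).trans_lt (v.2 h hlt)))

theorem isLeaf_iff_length_eq (hs : HasHeight s h) (v : SST s) :
    IsLeaf (graph s) (root s) v ↔ v.1.length = h := by
  rw [isLeaf_iff, ← Nat.le_zero, ← not_lt, hs]
  have := length_le_of_hasHeight hs v
  omega

/-- The vertex at depth `n` reached from the root by always choosing the child `0`. -/
def leftmost (hs : HasHeight s h) (n : ℕ) (hn : n ≤ h) : SST s :=
  ⟨List.replicate n 0, fun j hj => by
    simpa using (hs j).2 ((hj.trans_eq List.length_replicate).trans_le hn)⟩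

theorem length_leftmost (hs : HasHeight s h) {n : ℕ} (hn : n ≤ h) :
    (leftmost hs n hn).1.length = n :=
  List.length_replicate

theorem lt_card (hs : HasHeight s h) : h < Nat.card (SST s) := by
  let F (n : Fin (h + 1)) : SST s := leftmost hs n n.is_le
  have hF : Function.Injective F := fun a b hab => Fin.ext <| by
    simpa [F, length_leftmost] using congrArg (fun v => v.1.length) hab
  simpa using Nat.card_le_card_of_injective F hF

end SST

/-! ### The degree sequences of the Cantor trees -/

/-- The height of the Cantor tree `C_i`. -/
def height : ℕ → ℕ
  | 0 => 0
  | i + 1 => 2 * height i + 2 ^ i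

theorem two_mul_height (i : ℕ) : 2 * height i = i * 2 ^ i := by
  induction i with
  | zero => simp [height]
  | succ i ih => rw [height, mul_add, ih]; ring

theorem height_mono : Monotone height :=
  monotone_nat_of_le_succ fun i => by
    have := Nat.two_pow_pos i
    rw [height]
    omega

theorem le_height (i : ℕ) : i ≤ height i := by
  induction i with
  | zero => simp
  | succ i ih =>
    have := Nat.two_pow_pos i
    rw [height]
    omega

theorem length_cantorSeq (i : ℕ) : (cantorSeq i).length = height i + 1 := by
  induction i with
  | zero => simp [cantorSeq, height]
  | succ i ih =>
    have := Nat.two_pow_pos i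
    simp only [cantorSeq, List.length_append, ih, List.length_replicate, height]
    omega

theorem getD_cantorSeq_succ (i j : ℕ) : (cantorSeq (i + 1)).getD j 0 =
    if j ≤ height i then (cantorSeq i).getD j 0
    else if j < height i + 2 ^ i then 1
    else (cantorSeq i).getD (j - (height i + 2 ^ i)) 0 := by
  have hlen := length_cantorSeq i
  have := Nat.two_pow_pos i
  rw [cantorSeq, List.append_assoc]
  split_ifs with hfst hmid
  · rw [List.getD_append _ _ _ _ (by omega)]
  · rw [List.getD_append_right _ _ _ _ (by omega), List.getD_append _ _ _ _ (by simp; omega),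
      List.getD_replicate _ (by omega)]
  · rw [List.getD_append_right _ _ _ _ (by omega),
      List.getD_append_right _ _ _ _ (by simp; omega), List.length_replicate, hlen]
    congr 1
    omega

theorem getD_cantorSeq_pos_iff {i j : ℕ} : 0 < (cantorSeq i).getD j 0 ↔ j ≤ height i := by
  induction i generalizing j with
  | zero => cases j <;> simp [cantorSeq, height]
  | succ i ih =>
    have := Nat.two_pow_pos i
    rw [getD_cantorSeq_succ, height]
    split_ifs <;> (try rw [ih]) <;> omega

theorem getD_cantorSeq_le_two (i j : ℕ) : (cantorSeq i).getD j 0 ≤ 2 := by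
  induction i generalizing j with
  | zero => cases j <;> simp [cantorSeq]
  | succ i ih => grind [getD_cantorSeq_succ]

theorem IsBranchLevel.le_height {i a : ℕ} (ha : IsBranchLevel (cantorSeq i) a) : a ≤ height i :=
  getD_cantorSeq_pos_iff.1 (two_pos.trans_le ha)

theorem isBranchLevel_cantorSeq_succ {i z : ℕ} : IsBranchLevel (cantorSeq (i + 1)) z ↔
    IsBranchLevel (cantorSeq i) z ∨
      ∃ z', z = height i + 2 ^ i + z' ∧ IsBranchLevel (cantorSeq i) z' := by
  have hle (a : ℕ) := IsBranchLevel.le_height (i := i) (a := a)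
  have := Nat.two_pow_pos i
  rw [IsBranchLevel, getD_cantorSeq_succ]
  constructor
  · intro hz
    split_ifs at hz with hfst hmid
    · exact Or.inl hz
    · omega
    · exact Or.inr ⟨z - (height i + 2 ^ i), by omega, hz⟩
  · rintro (hz | ⟨z', rfl, hz⟩)
    · rwa [if_pos (hle z hz)]
    · rwa [if_neg (by omega), if_neg (by omega), Nat.add_sub_cancel_left]

theorem isBranchLevel_cantorSeq_zero_iff {z : ℕ} : IsBranchLevel (cantorSeq 0) z ↔ z = 0 := by
  cases z <;> simp [IsBranchLevel, cantorSeq]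

theorem isBranchLevel_zero (i : ℕ) : IsBranchLevel (cantorSeq i) 0 := by
  induction i with
  | zero => exact isBranchLevel_cantorSeq_zero_iff.2 rfl
  | succ i ih => exact isBranchLevel_cantorSeq_succ.2 (Or.inl ih)

theorem isBranchLevel_height (i : ℕ) : IsBranchLevel (cantorSeq i) (height i) := by
  induction i with
  | zero => exact isBranchLevel_zero 0
  | succ i ih =>
    exact isBranchLevel_cantorSeq_succ.2 (Or.inr ⟨height i, by rw [height]; ring, ih⟩)

theorem getD_cantorDegrees (i j : ℕ) :
    (cantorDegrees i).getD j 0 = if j < height i then (cantorSeq i).getD j 0 else 0 := by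
  have hlen := length_cantorSeq i
  rw [cantorDegrees]
  split_ifs with hj
  · rw [List.getD_append _ _ _ _ (by simp; omega), List.getD_eq_getElem _ _ (by simp; omega),
      List.getD_eq_getElem _ _ (by omega), List.getElem_dropLast]
  · rw [List.getD_append_right _ _ _ _ (by simp; omega)]
    cases j - (cantorSeq i).dropLast.length <;> simp

theorem hasHeight_cantorDegrees (i : ℕ) : HasHeight (cantorDegrees i) (height i) := by
  intro j
  rw [getD_cantorDegrees]
  split_ifs with hj
  · simpa [hj] using getD_cantorSeq_pos_iff.2 hj.le
  · simpa using hj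

theorem getD_cantorDegrees_le_two (i j : ℕ) : (cantorDegrees i).getD j 0 ≤ 2 := by
  rw [getD_cantorDegrees]
  split_ifs
  · exact getD_cantorSeq_le_two i j
  · exact Nat.zero_le 2

theorem isBranchLevel_cantorDegrees_iff {i a : ℕ} :
    IsBranchLevel (cantorDegrees i) a ↔ a < height i ∧ IsBranchLevel (cantorSeq i) a := by
  rw [IsBranchLevel, getD_cantorDegrees]
  split_ifs with ha <;> simp [ha, IsBranchLevel]

theorem tendsto_card_cantor :
    Filter.Tendsto (fun i => Nat.card (Cantor i)) Filter.atTop Filter.atTop :=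
  Filter.tendsto_atTop_mono
    (fun i => (le_height i).trans (SST.lt_card (hasHeight_cantorDegrees i)).le) Filter.tendsto_id

/-! ### Gaps between the branching levels -/

theorem exists_isBranchLevel_near (i x : ℕ) (hx : x ≤ height (i + 1)) :
    ∃ a, IsBranchLevel (cantorSeq (i + 1)) a ∧ a ≤ x ∧ x ≤ a + 2 ^ i := by
  induction i generalizing x with
  | zero => exact ⟨0, isBranchLevel_zero 1, Nat.zero_le x, by simpa [height] using hx⟩
  | succ i ih =>
    have : 2 ^ (i + 1) = 2 * 2 ^ i := pow_succ' 2 i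
    rcases Nat.lt_or_ge x (height (i + 1)) with hfst | hfst
    · obtain ⟨a, ha, hax, hxa⟩ := ih x hfst.le
      exact ⟨a, isBranchLevel_cantorSeq_succ.2 (Or.inl ha), hax, by omega⟩
    rcases Nat.lt_or_ge x (height (i + 1) + 2 ^ (i + 1)) with hmid | hmid
    · exact ⟨height (i + 1), isBranchLevel_cantorSeq_succ.2 (Or.inl (isBranchLevel_height _)),
        hfst, by omega⟩
    · obtain ⟨y, rfl⟩ := Nat.exists_eq_add_of_le hmid
      rw [height.eq_2 (i + 1)] at hx
      obtain ⟨a, ha, hay, hya⟩ := ih y (by omega)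
      exact ⟨_, isBranchLevel_cantorSeq_succ.2 (Or.inr ⟨a, rfl, ha⟩), by omega, by omega⟩

/- The window may lie partly outside the range of levels, which is what makes the induction go
through: passing to the second copy of `S_i` in `S_{i+1}` shifts the window to the left. -/
theorem exists_window_not_isBranchLevel (j i : ℕ) (a : ℤ) :
    ∃ y : ℤ, a ≤ y ∧ y ≤ a + height j + 2 ^ j ∧
      ∀ z : ℕ, y < z → (z : ℤ) < y + 2 ^ j → ¬ IsBranchLevel (cantorSeq (j + i)) z := by
  induction i generalizing a with
  | zero =>
    have : (0 : ℤ) < 2 ^ j := by positivity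
    by_cases ha : a + 2 ^ j ≤ 0
    · exact ⟨a, le_rfl, by omega, fun z _ _ _ => by omega⟩
    · refine ⟨max a (height j), le_max_left _ _, by omega, fun z _ _ hz => ?_⟩
      have := hz.le_height
      rw [add_zero] at this
      omega
  | succ i ih =>
    have hpow : (2 : ℤ) ^ j ≤ 2 ^ (j + i) := pow_le_pow_right₀ (by norm_num) (by omega)
    have hle (z : ℕ) := IsBranchLevel.le_height (i := j + i) (a := z)
    simp only [← add_assoc, isBranchLevel_cantorSeq_succ]
    by_cases ha : (height (j + i) : ℤ) ≤ a
    · obtain ⟨y, hay, hya, hfree⟩ := ih (a - (height (j + i) + 2 ^ (j + i)))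
      refine ⟨y + (height (j + i) + 2 ^ (j + i)), by omega, by omega, ?_⟩
      rintro z hz₁ hz₂ (hz | ⟨z', rfl, hz⟩)
      · have := hle z hz
        omega
      · push_cast at hz₁ hz₂
        exact hfree z' (by omega) (by omega) hz
    obtain ⟨y, hay, hya, hfree⟩ := ih a
    by_cases hy : y + 2 ^ j ≤ height (j + i) + 2 ^ (j + i)
    · refine ⟨y, hay, hya, ?_⟩
      rintro z hz₁ hz₂ (hz | ⟨z', rfl, _⟩)
      · exact hfree z hz₁ hz₂ hz
      · push_cast at hz₂
        omega
    · refine ⟨height (j + i), by omega, by omega, ?_⟩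
      rintro z hz₁ hz₂ (hz | ⟨z', rfl, _⟩)
      · have := hle z hz
        omega
      · push_cast at hz₂
        omega

theorem exists_interval_not_isBranchLevel {i j a b : ℕ} (hb : b ≤ height i)
    (hab : a + height j + 2 * 2 ^ j ≤ b) : ∃ y, a ≤ y ∧ y + 2 ^ j ≤ b ∧
    ∀ z, y < z → z < y + 2 ^ j → ¬ IsBranchLevel (cantorDegrees i) z := by
  have hji : j ≤ i := by
    by_contra! hij
    have := height_mono hij.le
    have := Nat.two_pow_pos j
    omega
  obtain ⟨n, rfl⟩ := Nat.exists_eq_add_of_le hji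
  obtain ⟨y, hay, hya, hfree⟩ := exists_window_not_isBranchLevel j n a
  lift y to ℕ using by omega
  norm_cast at hay hya
  exact ⟨y, hay, by omega, fun z hz₁ hz₂ hz =>
    hfree z (by omega) (by exact_mod_cast hz₂) (isBranchLevel_cantorDegrees_iff.1 hz).2⟩

/-! ### Times at which the descending chain and its restart separate -/

open Classical in
/-- The times `t ≤ h` such that one of the levels between `t - 2 ^ (k + 1)` and `t - 2 ^ k` is
branching. -/
def splitTimes (s : List ℕ) (h k : ℕ) : Finset ℕ :=
  {t ∈ Finset.Icc 1 h | ∃ a, IsBranchLevel s a ∧ a + 2 ^ k ≤ t ∧ t ≤ a + 2 ^ (k + 1)}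

theorem mem_splitTimes {s : List ℕ} {h k t : ℕ} : t ∈ splitTimes s h k ↔
    t ∈ Finset.Icc 1 h ∧ ∃ a, IsBranchLevel s a ∧ a + 2 ^ k ≤ t ∧ t ≤ a + 2 ^ (k + 1) := by
  classical exact Finset.mem_filter

theorem splitTimes_cantorDegrees (i k : ℕ) :
    splitTimes (cantorDegrees i) (height i) k = splitTimes (cantorSeq i) (height i) k := by
  ext t
  have := Nat.two_pow_pos k
  simp only [mem_splitTimes, isBranchLevel_cantorDegrees_iff, Finset.mem_Icc]
  exact and_congr_right fun ht => exists_congr fun a =>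
    ⟨fun ⟨⟨_, hb⟩, hlo, hhi⟩ => ⟨hb, hlo, hhi⟩, fun ⟨hb, hlo, hhi⟩ => ⟨⟨by omega, hb⟩, hlo, hhi⟩⟩

theorem le_card_splitTimes_succ (k : ℕ) :
    k * 2 ^ k + 1 ≤ (splitTimes (cantorSeq (k + 1)) (height (k + 1)) k).card := by
  have hsub : Finset.Icc (2 ^ k) (height (k + 1)) ⊆
      splitTimes (cantorSeq (k + 1)) (height (k + 1)) k := by
    intro t ht
    have := Nat.two_pow_pos k
    rw [Finset.mem_Icc] at ht
    obtain ⟨a, ha, hlo, hhi⟩ := exists_isBranchLevel_near k (t - 2 ^ k) (by omega)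
    exact mem_splitTimes.2 ⟨Finset.mem_Icc.2 (by omega), a, ha, by omega, by omega⟩
  have hcard := Finset.card_le_card hsub
  have hheight : height (k + 1) = k * 2 ^ k + 2 ^ k := by rw [height, two_mul_height]
  rw [Nat.card_Icc] at hcard
  omega

theorem two_mul_card_splitTimes_le (i k : ℕ) :
    2 * (splitTimes (cantorSeq i) (height i) k).card ≤
      (splitTimes (cantorSeq (i + 1)) (height (i + 1)) k).card := by
  classical
  set A := splitTimes (cantorSeq i) (height i) k
  set shift := addLeftEmbedding (height i + 2 ^ i)
  have hrange {t : ℕ} (ht : t ∈ A) : 1 ≤ t ∧ t ≤ height i :=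
    Finset.mem_Icc.1 (mem_splitTimes.1 ht).1
  have := Nat.two_pow_pos i
  have hdisj : Disjoint A (A.map shift) := by
    simp only [Finset.disjoint_right, Finset.forall_mem_map]
    intro t _ ht
    have : height i + 2 ^ i + t ≤ height i := (hrange ht).2
    omega
  calc 2 * A.card = (A ∪ A.map shift).card := by
        rw [Finset.card_union_of_disjoint hdisj, Finset.card_map, two_mul]
    _ ≤ _ := Finset.card_le_card ?_
  intro t ht
  rw [mem_splitTimes, Finset.mem_Icc, height]
  rcases Finset.mem_union.1 ht with ht | ht
  · obtain ⟨-, a, ha, hlo, hhi⟩ := mem_splitTimes.1 ht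
    have := hrange ht
    exact ⟨by omega, a, isBranchLevel_cantorSeq_succ.2 (Or.inl ha), hlo, hhi⟩
  · obtain ⟨t₀, ht₀, rfl⟩ := Finset.mem_map.1 ht
    obtain ⟨-, a, ha, hlo, hhi⟩ := mem_splitTimes.1 ht₀
    have := hrange ht₀
    simp only [shift, addLeftEmbedding_apply]
    exact ⟨by omega, _, isBranchLevel_cantorSeq_succ.2 (Or.inr ⟨a, rfl, ha⟩), by omega, by omega⟩

theorem le_card_splitTimes {i k : ℕ} (hk : k + 1 ≤ i) :
    (k + 1) * 2 ^ i ≤ 4 * (splitTimes (cantorSeq i) (height i) k).card := by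
  induction i, hk using Nat.le_induction with
  | base =>
    have := le_card_splitTimes_succ k
    have : (k + 1) * 2 ^ (k + 1) ≤ 4 * (k * 2 ^ k + 1) := by
      rcases Nat.eq_zero_or_pos k with rfl | hk
      · norm_num
      · rw [pow_succ]
        nlinarith [Nat.two_pow_pos k, Nat.mul_le_mul_right (2 ^ k) hk]
    omega
  | succ i _ ih =>
    have := two_mul_card_splitTimes_le i k
    rw [pow_succ]
    linarith

theorem mul_height_le_sum_card_splitTimes (i : ℕ) : i * height i ≤
    4 * ∑ k ∈ Finset.range i, (splitTimes (cantorDegrees i) (height i) k).card := by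
  simp only [splitTimes_cantorDegrees]
  have hsum : ∑ k ∈ Finset.range i, (k + 1) * 2 ^ i ≤
      ∑ k ∈ Finset.range i, 4 * (splitTimes (cantorSeq i) (height i) k).card :=
    Finset.sum_le_sum fun k hk => le_card_splitTimes (Finset.mem_range.1 hk)
  have hgauss : (∑ k ∈ Finset.range i, (k + 1)) * 2 = i * (i + 1) := by
    have := Finset.sum_range_id_mul_two (i + 1)
    rw [Finset.sum_range_succ'] at this
    simpa [mul_comm] using this
  rw [← Finset.mul_sum, ← Finset.sum_mul] at hsum
  nlinarith [two_mul_height i, Nat.two_pow_pos i]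

/-! ### Expectations and the Markov property -/

section Markov

variable {α β : Type*} {Ω : Type}

theorem expect_bind (μ : PMF α) (κ : α → PMF β) (g : β → ℝ≥0∞) :
    expect (μ.bind κ) g = expect μ fun a => expect (κ a) g := by
  simp only [expect, PMF.bind_apply, ← ENNReal.tsum_mul_right, ← ENNReal.tsum_mul_left]
  rw [ENNReal.tsum_comm]
  simp only [mul_assoc]

@[simp]
theorem expect_pure (a : α) (g : α → ℝ≥0∞) : expect (PMF.pure a) g = g a := by
  rw [expect, tsum_eq_single a fun b hb => by simp [hb]]
  simp

theorem expect_map (μ : PMF α) (φ : α → β) (g : β → ℝ≥0∞) :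
    expect (μ.map φ) g = expect μ fun a => g (φ a) := by
  simp [← PMF.bind_pure_comp, expect_bind]

theorem expect_mono (μ : PMF α) {g g' : α → ℝ≥0∞} (h : ∀ a ∈ μ.support, g a ≤ g' a) :
    expect μ g ≤ expect μ g' := by
  refine ENNReal.tsum_le_tsum fun a => ?_
  by_cases ha : a ∈ μ.support
  · exact mul_le_mul_right (h a ha) _
  · simp [(PMF.apply_eq_zero_iff μ a).2 ha]

theorem expect_add (μ : PMF α) (g g' : α → ℝ≥0∞) :
    expect μ (fun a => g a + g' a) = expect μ g + expect μ g' := by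
  simp only [expect, mul_add, ENNReal.tsum_add]

theorem expect_const_mul (μ : PMF α) (c : ℝ≥0∞) (g : α → ℝ≥0∞) :
    expect μ (fun a => c * g a) = c * expect μ g := by
  simp only [expect, mul_left_comm _ c, ENNReal.tsum_mul_left]

@[simp]
theorem expect_const (μ : PMF α) (c : ℝ≥0∞) : expect μ (fun _ => c) = c := by
  simp [expect, ENNReal.tsum_mul_right, PMF.tsum_coe]

theorem chainLaw_add (init : PMF Ω) (step : Ω → PMF Ω) (s n : ℕ) :
    chainLaw init step (s + n) =
      (chainLaw init step s).bind fun x => chainLaw (PMF.pure x) step n := by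
  induction n with
  | zero => simp [chainLaw]
  | succ n ih => rw [← add_assoc, chainLaw, ih, PMF.bind_bind]; rfl

theorem chainLaw_pure_succ (step : Ω → PMF Ω) (x : Ω) (n : ℕ) :
    chainLaw (PMF.pure x) step (n + 1) =
      (step x).bind fun y => chainLaw (PMF.pure y) step n := by
  rw [add_comm, chainLaw_add]
  simp [chainLaw]

/-- The expectation of `g (X_s, X_t)` for `s ≤ t`. -/
def pairExpect (init : PMF Ω) (step : Ω → PMF Ω) (g : Ω → Ω → ℝ≥0∞) (s t : ℕ) : ℝ≥0∞ :=
  expect (chainLaw init step s) fun x => expect (chainLaw (PMF.pure x) step (t - s)) (g x)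

theorem expect_splitLaw (init : PMF Ω) (step : Ω → PMF Ω) (s t : ℕ) (g : Ω × Ω → ℝ≥0∞) :
    expect (splitLaw init step s t) g = expect (chainLaw init step s) fun x =>
      expect (chainLaw (PMF.pure x) step (t - s)) fun y =>
        expect (chainLaw (PMF.pure x) step (t - s)) fun z => g (y, z) := by
  simp only [splitLaw, expect_bind, expect_map]

theorem expect_stepLaw (init : PMF Ω) (step : Ω → PMF Ω) (t : ℕ) (g : Ω × Ω → ℝ≥0∞) :
    expect (stepLaw init step t) g = pairExpect init step (fun x y => g (x, y)) t (t + 1) := by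
  simp only [stepLaw, pairExpect, expect_bind, expect_map, Nat.add_sub_cancel_left,
    chainLaw, PMF.pure_bind]

theorem expect_chainLaw_chainLaw (init : PMF Ω) (step : Ω → PMF Ω) {r s : ℕ} (hrs : r ≤ s)
    (g : Ω → ℝ≥0∞) :
    expect (chainLaw init step r) (fun x => expect (chainLaw (PMF.pure x) step (s - r)) g) =
      expect (chainLaw init step s) g := by
  rw [← expect_bind, ← chainLaw_add, Nat.add_sub_cancel' hrs]

/-! ### Fork convexity implies Markov convexity -/

/-- The four-point inequality of Lee, Naor and Peres which implies Markov `q`-convexity: in a fork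
with handle `x`, branching point `y` and tips `z`, `w`, the tips are not both far away from `x`
and far away from each other. -/
def IsForkConvex (X : Type*) [EDist X] (q : ℝ) (B : ℝ≥0∞) : Prop :=
  ∀ x y z w : X, 2 / (2 : ℝ≥0∞) ^ q * (edist x z ^ q + edist x w ^ q) + B * edist z w ^ q ≤
    edist y z ^ q + edist y w ^ q + 2 * edist x y ^ q

variable {X : Type*}

theorem IsForkConvex.pairExpect_add_expect_splitLaw_le [EDist X] {q : ℝ} {B : ℝ≥0∞}
    (hX : IsForkConvex X q B) (init : PMF Ω) (step : Ω → PMF Ω) (f : Ω → X) {r s t : ℕ}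
    (hrs : r ≤ s) (hst : s ≤ t) :
    2 / (2 : ℝ≥0∞) ^ q * (2 * pairExpect init step (fun x y => edist (f x) (f y) ^ q) r t) +
      B * expect (splitLaw init step s t) (fun z => edist (f z.1) (f z.2) ^ q) ≤
    2 * pairExpect init step (fun x y => edist (f x) (f y) ^ q) s t +
      2 * pairExpect init step (fun x y => edist (f x) (f y) ^ q) r s := by
  have hfork := expect_mono (chainLaw init step r) fun x _ =>
    expect_mono (chainLaw (PMF.pure x) step (s - r)) fun y _ =>
      expect_mono (chainLaw (PMF.pure y) step (t - s)) fun z _ =>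
        expect_mono (chainLaw (PMF.pure y) step (t - s)) fun w _ => hX (f x) (f y) (f z) (f w)
  have hhandle (x : Ω) := expect_chainLaw_chainLaw (PMF.pure x) step
    (show s - r ≤ t - r by omega) (g := fun z => edist (f x) (f z) ^ q)
  rw [show t - r - (s - r) = t - s by omega] at hhandle
  simp only [expect_add, expect_const_mul, expect_const, hhandle] at hfork
  simp only [expect_chainLaw_chainLaw init step hrs fun y =>
      expect (chainLaw (PMF.pure y) step (t - s)) fun z => edist (f y) (f z) ^ q,
    expect_chainLaw_chainLaw init step hrs fun y =>
      expect (chainLaw (PMF.pure y) step (t - s)) fun z =>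
        expect (chainLaw (PMF.pure y) step (t - s)) fun w => edist (f z) (f w) ^ q] at hfork
  simpa only [expect_splitLaw, pairExpect, two_mul] using hfork

/-- The sum over `1 ≤ t ≤ n` of the expectations of `g (X_{t - a}, X_t)`. -/
def lagSum (init : PMF Ω) (step : Ω → PMF Ω) (g : Ω → Ω → ℝ≥0∞) (n a : ℕ) : ℝ≥0∞ :=
  ∑ t ∈ Finset.Icc 1 n, pairExpect init step g (t - a) t

/-- The sum over `1 ≤ t ≤ n` of the expectations of `g (X_t, X̃_t(t - a))`. -/
def splitSum (init : PMF Ω) (step : Ω → PMF Ω) (g : Ω → Ω → ℝ≥0∞) (n a : ℕ) : ℝ≥0∞ :=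
  ∑ t ∈ Finset.Icc 1 n, expect (splitLaw init step (t - a) t) fun z => g z.1 z.2

theorem sum_shift_le {M : Type*} [AddCommMonoid M] [PartialOrder M] [CanonicallyOrderedAdd M]
    {D : ℕ → ℕ → M} (hD : D 0 0 = 0) (n a : ℕ) :
    ∑ t ∈ Finset.Icc 1 n, D (t - 2 * a) (t - a) ≤ ∑ t ∈ Finset.Icc 1 n, D (t - a) t := by
  calc ∑ t ∈ Finset.Icc 1 n, D (t - 2 * a) (t - a)
      = ∑ t ∈ (Finset.Icc 1 (n - a)).map (addRightEmbedding a), D (t - 2 * a) (t - a) := by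
        rw [Finset.map_add_right_Icc]
        refine (Finset.sum_subset_zero_on_sdiff (fun t ht => ?_) (fun t ht => ?_)
          fun _ _ => rfl).symm
        all_goals simp only [Finset.mem_sdiff, Finset.mem_Icc] at ht ⊢
        · omega
        · rwa [show t - 2 * a = 0 by omega, show t - a = 0 by omega]
    _ = ∑ t ∈ Finset.Icc 1 (n - a), D (t - a) t := by
        rw [Finset.sum_map]
        refine Finset.sum_congr rfl fun t _ => ?_
        rw [addRightEmbedding_apply, Nat.add_sub_cancel, two_mul, Nat.add_sub_add_right]
    _ ≤ _ := Finset.sum_le_sum_of_subset (Finset.Icc_subset_Icc_right (Nat.sub_le n a))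

theorem add_sum_range_le_of_succ_add_le {M : Type*} [AddCommMonoid M] [Preorder M]
    [IsOrderedAddMonoid M] {a b : ℕ → M} (h : ∀ k, a (k + 1) + b k ≤ a k) (n : ℕ) :
    a n + ∑ k ∈ Finset.range n, b k ≤ a 0 := by
  induction n with
  | zero => simp
  | succ n ih =>
    rw [Finset.sum_range_succ, add_comm _ (b n), ← add_assoc]
    exact (add_le_add_left (h n) _).trans ih

theorem IsForkConvex.lagSum_add_splitSum_le [PseudoEMetricSpace X] {q : ℝ} (hq : 0 < q)
    {B : ℝ≥0∞} (hX : IsForkConvex X q B) (init : PMF Ω) (step : Ω → PMF Ω) (f : Ω → X)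
    (n a : ℕ) :
    lagSum init step (fun x y => edist (f x) (f y) ^ q) n (2 * a) / 2 ^ q +
      B / 4 * splitSum init step (fun x y => edist (f x) (f y) ^ q) n a ≤
    lagSum init step (fun x y => edist (f x) (f y) ^ q) n a := by
  set g : Ω → Ω → ℝ≥0∞ := fun x y => edist (f x) (f y) ^ q
  have hstart : pairExpect init step g 0 0 = 0 := by
    simp [g, pairExpect, chainLaw, hq]
  have hsum := Finset.sum_le_sum fun t (_ : t ∈ Finset.Icc 1 n) =>
    hX.pairExpect_add_expect_splitLaw_le init step f (r := t - 2 * a) (s := t - a) (t := t)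
      (by omega) (Nat.sub_le _ _)
  simp only [Finset.sum_add_distrib, ← Finset.mul_sum] at hsum
  have hshift : 2 / 2 ^ q * (2 * lagSum init step g n (2 * a)) + B * splitSum init step g n a ≤
      4 * lagSum init step g n a := by
    refine hsum.trans ((add_le_add_right (mul_le_mul_right (sum_shift_le hstart n a) _) _).trans_eq
      ?_)
    rw [lagSum, ← add_mul, two_add_two_eq_four]
  have hfour : (4 : ℝ≥0∞) ≠ 0 := by norm_num
  have hfour' : (4 : ℝ≥0∞) ≠ ⊤ := by norm_num
  rw [← ENNReal.mul_le_mul_iff_right hfour hfour']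
  refine Eq.trans_le ?_ hshift
  rw [mul_add, ← mul_assoc 4 (B / 4), ENNReal.mul_div_cancel hfour hfour']
  simp only [div_eq_mul_inv]
  ring

theorem IsForkConvex.lagSum_div_add_splitSum_div_le [PseudoEMetricSpace X] {q : ℝ} (hq : 0 < q)
    {B : ℝ≥0∞} (hX : IsForkConvex X q B) (init : PMF Ω) (step : Ω → PMF Ω) (f : Ω → X)
    (n k : ℕ) :
    lagSum init step (fun x y => edist (f x) (f y) ^ q) n (2 ^ (k + 1)) /
        2 ^ (((k + 1 : ℕ) : ℝ) * q) +
      B / 4 * (splitSum init step (fun x y => edist (f x) (f y) ^ q) n (2 ^ k) /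
        2 ^ ((k : ℝ) * q)) ≤
    lagSum init step (fun x y => edist (f x) (f y) ^ q) n (2 ^ k) / 2 ^ ((k : ℝ) * q) := by
  have h := ENNReal.div_le_div_right
    (hX.lagSum_add_splitSum_le hq init step f n (2 ^ k)) (2 ^ ((k : ℝ) * q))
  rw [← pow_succ', ENNReal.add_div, mul_div_assoc] at h
  simp only [Nat.cast_succ, add_one_mul (k : ℝ),
    ENNReal.rpow_add _ _ two_ne_zero ENNReal.ofNat_ne_top]
  rwa [div_eq_mul_inv, mul_comm (2 ^ ((k : ℝ) * q)),
    ENNReal.mul_inv (.inl (by simp)) (.inr (by simp)), ← mul_assoc, ← div_eq_mul_inv,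
    ← div_eq_mul_inv]

theorem IsForkConvex.isMarkovConvexWith [PseudoEMetricSpace X] {q : ℝ} (hq : 0 < q)
    {c : ℝ≥0} (hc : 0 < c) (hX : IsForkConvex X q c) :
    IsMarkovConvexWith X q ((4 / c) ^ (1 / q)) := by
  intro Ω init step f m
  set g : Ω → Ω → ℝ≥0∞ := fun x y => edist (f x) (f y) ^ q
  set L : ℕ → ℝ≥0∞ := fun k => lagSum init step g (2 ^ m) (2 ^ k) / 2 ^ ((k : ℝ) * q) with hL
  set S : ℕ → ℝ≥0∞ := fun k => splitSum init step g (2 ^ m) (2 ^ k) / 2 ^ ((k : ℝ) * q) with hS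
  have hscale (k : ℕ) : L (k + 1) + c / 4 * S k ≤ L k :=
    hX.lagSum_div_add_splitSum_div_le hq init step f (2 ^ m) k
  have htelescope : c / 4 * ∑ k ∈ Finset.range (m + 1), S k ≤ L 0 := by
    rw [Finset.mul_sum]
    exact le_add_self.trans (add_sum_range_le_of_succ_add_le hscale (m + 1))
  have hL₀ : L 0 = ∑ t ∈ Finset.Icc 1 (2 ^ m),
      expect (stepLaw init step (t - 1)) (fun z => edist (f z.2) (f z.1) ^ q) := by
    simp only [hL, lagSum, Nat.cast_zero, zero_mul, ENNReal.rpow_zero, div_one, pow_zero]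
    refine Finset.sum_congr rfl fun t ht => ?_
    rw [expect_stepLaw, Nat.sub_add_cancel (Finset.mem_Icc.1 ht).1]
    simp only [g, edist_comm]
  have hC : (((4 / c) ^ (1 / q) : ℝ≥0) : ℝ≥0∞) ^ q = (c / 4 : ℝ≥0∞)⁻¹ := by
    rw [← ENNReal.coe_rpow_of_nonneg _ hq.le, ← NNReal.rpow_mul, one_div,
      inv_mul_cancel₀ hq.ne', NNReal.rpow_one, ENNReal.coe_div hc.ne',
      ENNReal.inv_div (by norm_num) (by norm_num)]
    rfl
  have hc₀ : (c / 4 : ℝ≥0∞) ≠ 0 := by simpa using hc.ne'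
  have hc' : (c / 4 : ℝ≥0∞) ≠ ⊤ := ENNReal.div_ne_top ENNReal.coe_ne_top (by norm_num)
  rw [hC, ← hL₀]
  calc _ = ∑ k ∈ Finset.range (m + 1), S k := by
        simp only [hS, splitSum, g, div_eq_mul_inv, Finset.sum_mul]
    _ ≤ _ := by rwa [mul_comm, ← div_eq_mul_inv, ENNReal.le_div_iff_mul_le (.inl hc₀) (.inl hc'),
      mul_comm]

end Markov

/-! ### Markov convexity and distortion -/

/-- The best constant `K` in `u x y ≤ K * v x y`, for `x ≠ y`. The distortion of a map is a product
of two such constants. -/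
def supRatio {X : Type*} (u v : X → X → ℝ≥0∞) : ℝ≥0∞ :=
  ⨆ (x : X) (y : X) (_ : x ≠ y), u x y / v x y

theorem le_supRatio_mul {X : Type*} {u v : X → X → ℝ≥0∞} (hu : ∀ x, u x x = 0)
    (hv : ∀ x y, v x y = 0 → x = y) (hv' : ∀ x y, v x y ≠ ⊤) (x y : X) :
    u x y ≤ supRatio u v * v x y := by
  rcases eq_or_ne x y with rfl | hxy
  · simp only [hu, zero_le]
  · exact (ENNReal.div_le_iff (fun h => hxy (hv x y h)) (hv' x y)).1
      (le_iSup_of_le x (le_iSup₂_of_le y hxy le_rfl))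

theorem supRatio_ne_top {X : Type*} {u v : X → X → ℝ≥0∞} (hv : ∀ x, v x x = 0)
    (hv' : ∀ x y, v x y = 0 → x = y) (hu : ∀ x y, u x y = 0 → x = y) (hu' : ∀ x y, u x y ≠ ⊤)
    (h : supRatio u v * supRatio v u ≠ ⊤) : supRatio u v ≠ ⊤ := by
  intro htop
  have hzero : supRatio v u = 0 := by
    by_contra h₀
    exact h (by rw [htop, ENNReal.top_mul h₀])
  have heq (x y : X) : x = y := by
    have hle := le_supRatio_mul hv hu hu' x y
    rw [hzero, zero_mul, nonpos_iff_eq_zero] at hle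
    exact hv' x y hle
  have hbot : supRatio u v ≤ 0 := iSup₂_le fun x y => iSup_le fun hne => (hne (heq x y)).elim
  simp [htop] at hbot

theorem exists_lipschitzWith_antilipschitzWith {X Y : Type*} [MetricSpace X] [MetricSpace Y]
    {f : X → Y} (hf : f.Injective) (h : mapDistortion f ≠ ⊤) :
    ∃ A B : ℝ≥0, (A : ℝ≥0∞) * B = mapDistortion f ∧ LipschitzWith A f ∧ AntilipschitzWith B f := by
  set u : X → X → ℝ≥0∞ := fun x y => edist (f x) (f y)
  have hu (x : X) : u x x = 0 := edist_self _
  have hu' (x y : X) (hxy : u x y = 0) : x = y := hf (edist_eq_zero.1 hxy)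
  have hu'' (x y : X) : u x y ≠ ⊤ := edist_ne_top _ _
  have hv (x y : X) (hxy : edist x y = 0) : x = y := edist_eq_zero.1 hxy
  have hmul : supRatio u edist * supRatio edist u = mapDistortion f := rfl
  have hA : supRatio u edist ≠ ⊤ := supRatio_ne_top edist_self hv hu' hu'' h
  have hB : supRatio edist u ≠ ⊤ := supRatio_ne_top hu hu' hv edist_ne_top (by rwa [mul_comm])
  refine ⟨(supRatio u edist).toNNReal, (supRatio edist u).toNNReal, ?_, fun x y => ?_,
    fun x y => ?_⟩ <;> simp only [ENNReal.coe_toNNReal hA, ENNReal.coe_toNNReal hB]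
  · exact hmul
  · exact le_supRatio_mul hu hv edist_ne_top x y
  · exact le_supRatio_mul edist_self hu' hu'' x y

theorem IsMarkovConvexWith.of_lipschitzWith {X Y : Type*} [PseudoEMetricSpace X]
    [PseudoEMetricSpace Y] {q : ℝ} (hq : 0 ≤ q) {C A B : ℝ≥0} (hY : IsMarkovConvexWith Y q C)
    {F : X → Y} (hA : LipschitzWith A F) (hB : AntilipschitzWith B F) :
    IsMarkovConvexWith X q (A * B * C) := by
  intro Ω init step f m
  have hA' (x y : X) : edist (F x) (F y) ^ q ≤ (A : ℝ≥0∞) ^ q * edist x y ^ q := by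
    rw [← ENNReal.mul_rpow_of_nonneg _ _ hq]
    exact ENNReal.rpow_le_rpow (hA x y) hq
  have hB' (x y : X) : edist x y ^ q ≤ (B : ℝ≥0∞) ^ q * edist (F x) (F y) ^ q := by
    rw [← ENNReal.mul_rpow_of_nonneg _ _ hq]
    exact ENNReal.rpow_le_rpow (hB x y) hq
  calc _ ≤ (B : ℝ≥0∞) ^ q * ∑ k ∈ Finset.range (m + 1), ∑ t ∈ Finset.Icc 1 (2 ^ m),
        expect (splitLaw init step (t - 2 ^ k) t)
          (fun z => edist (F (f z.1)) (F (f z.2)) ^ q) / (2 : ℝ≥0∞) ^ ((k : ℝ) * q) := by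
        simp only [Finset.mul_sum]
        refine Finset.sum_le_sum fun k _ => Finset.sum_le_sum fun t _ => ?_
        rw [← mul_div_assoc, ← expect_const_mul]
        exact ENNReal.div_le_div_right (expect_mono _ fun z _ => hB' _ _) _
    _ ≤ (B : ℝ≥0∞) ^ q * ((C : ℝ≥0∞) ^ q * ∑ t ∈ Finset.Icc 1 (2 ^ m),
          expect (stepLaw init step (t - 1)) (fun z => edist (F (f z.2)) (F (f z.1)) ^ q)) :=
        mul_le_mul_right (hY Ω init step (F ∘ f) m) _
    _ ≤ (B : ℝ≥0∞) ^ q * ((C : ℝ≥0∞) ^ q * ((A : ℝ≥0∞) ^ q * ∑ t ∈ Finset.Icc 1 (2 ^ m),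
          expect (stepLaw init step (t - 1)) (fun z => edist (f z.2) (f z.1) ^ q))) := by
        gcongr
        simp only [Finset.mul_sum]
        refine Finset.sum_le_sum fun t _ => ?_
        rw [← expect_const_mul]
        exact expect_mono _ fun z _ => hA' _ _
    _ = _ := by
        push_cast
        rw [ENNReal.mul_rpow_of_nonneg _ _ hq, ENNReal.mul_rpow_of_nonneg _ _ hq]
        ring

theorem markovConvexity_le_mul_distortion {X Y : Type*} [MetricSpace X] [MetricSpace Y] {q : ℝ}
    (hq : 0 ≤ q) {C : ℝ≥0} (hC : 0 < C) (hY : IsMarkovConvexWith Y q C) :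
    markovConvexity q X ≤ C * distortion X Y := by
  have hC' : (C : ℝ≥0∞) ≠ 0 := by simpa using hC.ne'
  simp only [distortion, ENNReal.mul_iInf_of_ne hC' ENNReal.coe_ne_top]
  refine le_iInf₂ fun f hf => ?_
  by_cases htop : mapDistortion f = ⊤
  · simp [htop, ENNReal.mul_top hC']
  · obtain ⟨A, B, hAB, hA, hB⟩ := exists_lipschitzWith_antilipschitzWith hf htop
    calc markovConvexity q X ≤ ((A * B * C : ℝ≥0) : ℝ≥0∞) :=
          iInf₂_le _ (hY.of_lipschitzWith hq hA hB)
      _ = C * mapDistortion f := by rw [← hAB]; push_cast; ring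

/-! ### Two-point inequalities -/

theorem rpow_mean_le {a b r : ℝ} (ha : 0 ≤ a) (hb : 0 ≤ b) (hr : 1 ≤ r) :
    ((a + b) / 2) ^ r ≤ (a ^ r + b ^ r) / 2 := by
  have h := (convexOn_rpow hr).2 (Set.mem_Ici.2 ha) (Set.mem_Ici.2 hb)
    (by norm_num : (0 : ℝ) ≤ 1 / 2) (by norm_num : (0 : ℝ) ≤ 1 / 2) (by norm_num)
  simp only [smul_eq_mul] at h
  calc ((a + b) / 2) ^ r = (1 / 2 * a + 1 / 2 * b) ^ r := by ring_nf
    _ ≤ 1 / 2 * a ^ r + 1 / 2 * b ^ r := h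
    _ = (a ^ r + b ^ r) / 2 := by ring

theorem sq_rpow_half {x : ℝ} (hx : 0 ≤ x) (p : ℝ) : (x ^ 2) ^ (p / 2) = x ^ p := by
  rw [← Real.rpow_natCast, ← Real.rpow_mul hx]
  congr 1; push_cast; ring

theorem rpow_add_rpow_le_mean {p : ℝ} (hp : 2 ≤ p) (a b : ℝ) :
    |a| ^ p + |b| ^ p ≤ (|a + b| ^ p + |a - b| ^ p) / 2 := by
  have hr : 1 ≤ p / 2 := by linarith
  simp only [← sq_rpow_half (abs_nonneg _) p, sq_abs]
  calc (a ^ 2) ^ (p / 2) + (b ^ 2) ^ (p / 2) ≤ (a ^ 2 + b ^ 2) ^ (p / 2) :=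
        Real.add_rpow_le_rpow_add (sq_nonneg a) (sq_nonneg b) hr
    _ = (((a + b) ^ 2 + (a - b) ^ 2) / 2) ^ (p / 2) := by congr 1; ring
    _ ≤ _ := rpow_mean_le (sq_nonneg (a + b)) (sq_nonneg (a - b)) hr

theorem convexOn_rpow_sub_mul_sq {p : ℝ} (hp : 1 ≤ p) (hp' : p ≤ 2) :
    ConvexOn ℝ (Set.Icc (0 : ℝ) 2) fun x => x ^ p - p * (p - 1) / 4 * x ^ 2 := by
  set k := p * (p - 1) / 4
  refine convexOn_of_hasDerivWithinAt2_nonneg (convex_Icc 0 2)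
    (f' := fun x => p * x ^ (p - 1) - k * (2 * x))
    (f'' := fun x => p * ((p - 1) * x ^ (p - 1 - 1)) - k * 2)
    (.sub (Real.continuous_rpow_const (by linarith)).continuousOn (by fun_prop)) ?_ ?_ ?_ <;>
  intro x hx <;> rw [interior_Icc] at hx
  · refine ((Real.hasDerivAt_rpow_const (.inl hx.1.ne')).sub ?_).hasDerivWithinAt
    simpa using (hasDerivAt_pow 2 x).const_mul k
  · refine (((Real.hasDerivAt_rpow_const (.inl hx.1.ne')).const_mul p).sub ?_).hasDerivWithinAt
    simpa using ((hasDerivAt_id x).const_mul 2).const_mul k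
  · have hx' : (1 / 2 : ℝ) ≤ x ^ (p - 1 - 1) :=
      calc (1 / 2 : ℝ) = 2 ^ (-1 : ℝ) := by rw [Real.rpow_neg_one]; norm_num
        _ ≤ 2 ^ (p - 1 - 1) := Real.rpow_le_rpow_of_exponent_le (by norm_num) (by linarith)
        _ ≤ x ^ (p - 1 - 1) := Real.rpow_le_rpow_of_nonpos hx.1 hx.2.le (by linarith)
    have hk : 0 ≤ p * (p - 1) := mul_nonneg (by linarith) (by linarith)
    have hk' : k * 2 = p * (p - 1) * (1 / 2) := by ring
    linarith [mul_le_mul_of_nonneg_left hx' hk]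

theorem one_add_mul_sq_le_mean {p t : ℝ} (hp : 1 ≤ p) (hp' : p ≤ 2) (ht : 0 ≤ t) (ht' : t ≤ 1) :
    1 + p * (p - 1) / 4 * t ^ 2 ≤ ((1 + t) ^ p + (1 - t) ^ p) / 2 := by
  have h := (convexOn_rpow_sub_mul_sq hp hp').2 (x := 1 + t) (y := 1 - t)
    ⟨by linarith, by linarith⟩ ⟨by linarith, by linarith⟩ (by norm_num : (0 : ℝ) ≤ 1 / 2)
    (by norm_num : (0 : ℝ) ≤ 1 / 2) (by norm_num)
  simp only [smul_eq_mul] at h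
  rw [show 1 / 2 * (1 + t) + 1 / 2 * (1 - t) = 1 by ring, Real.one_rpow] at h
  linarith

theorem rpow_half_le_mean_of_le {p a b : ℝ} (hp : 1 ≤ p) (hp' : p ≤ 2) (hb : 0 ≤ b)
    (hba : b ≤ a) :
    (a ^ 2 + (p - 1) / 2 * b ^ 2) ^ (p / 2) ≤ ((a + b) ^ p + (a - b) ^ p) / 2 := by
  obtain ⟨t, ht, ht', rfl⟩ : ∃ t, 0 ≤ t ∧ t ≤ 1 ∧ a * t = b := by
    rcases (hb.trans hba).eq_or_lt with rfl | ha
    · exact ⟨0, le_rfl, zero_le_one, by linarith⟩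
    · exact ⟨b / a, by positivity, (div_le_one ha).2 hba, mul_div_cancel₀ b ha.ne'⟩
  have ha : 0 ≤ a := hb.trans hba
  have hk : 0 ≤ (p - 1) / 2 * t ^ 2 := mul_nonneg (by linarith) (sq_nonneg t)
  calc (a ^ 2 + (p - 1) / 2 * (a * t) ^ 2) ^ (p / 2)
      = a ^ p * (1 + (p - 1) / 2 * t ^ 2) ^ (p / 2) := by
        rw [← sq_rpow_half ha, ← Real.mul_rpow (by positivity) (by linarith)]
        ring_nf
    _ ≤ a ^ p * (1 + p / 2 * ((p - 1) / 2 * t ^ 2)) := by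
        gcongr
        exact rpow_one_add_le_one_add_mul_self (by linarith) (by linarith) (by linarith)
    _ ≤ a ^ p * (((1 + t) ^ p + (1 - t) ^ p) / 2) := by
        gcongr
        linarith [one_add_mul_sq_le_mean hp hp' ht ht']
    _ = ((a + a * t) ^ p + (a - a * t) ^ p) / 2 := by
        rw [show a + a * t = a * (1 + t) by ring, show a - a * t = a * (1 - t) by ring,
          Real.mul_rpow ha (by linarith), Real.mul_rpow ha (by linarith)]
        ring

theorem abs_add_abs_sub_comp (φ : ℝ → ℝ) (a b : ℝ) :
    φ |a + b| + φ |a - b| = φ (|a| + |b|) + φ |(|a| - |b|)| := by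
  grind

theorem rpow_half_le_mean {p : ℝ} (hp : 1 ≤ p) (hp' : p ≤ 2) (a b : ℝ) :
    (a ^ 2 + (p - 1) / 2 * b ^ 2) ^ (p / 2) ≤ (|a + b| ^ p + |a - b| ^ p) / 2 := by
  rw [abs_add_abs_sub_comp (· ^ p), ← sq_abs a, ← sq_abs b]
  rcases le_total |b| |a| with h | h
  · rw [abs_of_nonneg (sub_nonneg.2 h)]
    exact rpow_half_le_mean_of_le hp hp' (abs_nonneg b) h
  · rw [abs_sub_comm, abs_of_nonneg (sub_nonneg.2 h), add_comm |a|]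
    refine le_trans ?_ (rpow_half_le_mean_of_le hp hp' (abs_nonneg a) h)
    have : 0 ≤ (p - 1) / 2 := by linarith
    have hsq : |a| ^ 2 ≤ |b| ^ 2 := by gcongr
    refine Real.rpow_le_rpow (by positivity) ?_ (by positivity)
    linarith [mul_le_mul_of_nonneg_left hsq (by linarith : 0 ≤ 1 - (p - 1) / 2)]

theorem rpow_mul_add_rpow_mul_le {p : ℝ} (hp : 0 < p) (hp' : p < 2) {x y X Y : ℝ} (hx : 0 ≤ x)
    (hy : 0 ≤ y) (hX : 0 ≤ X) (hY : 0 ≤ Y) :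
    x ^ p * X ^ (2 - p) + y ^ p * Y ^ (2 - p) ≤
      (x ^ 2 + y ^ 2) ^ (p / 2) * (X ^ 2 + Y ^ 2) ^ ((2 - p) / 2) := by
  have hpos : 0 < 2 - p := by linarith
  have hconj : (2 / p).HolderConjugate (2 / (2 - p)) := by
    rw [Real.holderConjugate_iff]
    refine ⟨by rw [lt_div_iff₀ hp]; linarith, ?_⟩
    field_simp
    ring
  have h := Real.inner_le_Lp_mul_Lq_of_nonneg Finset.univ (f := ![x ^ p, y ^ p])
    (g := ![X ^ (2 - p), Y ^ (2 - p)]) hconj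
    (fun i _ => by fin_cases i <;> exact Real.rpow_nonneg ‹_› _)
    (fun i _ => by fin_cases i <;> exact Real.rpow_nonneg ‹_› _)
  have hpow {r z : ℝ} (hr : r ≠ 0) (hz : 0 ≤ z) : (z ^ r) ^ (2 / r) = z ^ 2 := by
    rw [← Real.rpow_mul hz, mul_div_cancel₀ _ hr, Real.rpow_two]
  simpa [Fin.sum_univ_two, hpow hp.ne', hpow hpos.ne', hx, hy, hX, hY] using h

theorem le_mean_sq_of_rpow_half_le {p W A B : ℝ} (hp : 0 < p) (hp' : p ≤ 2) (hW : 0 ≤ W)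
    (hA : 0 ≤ A) (hB : 0 ≤ B) (h : W ^ (p / 2) ≤ (A ^ p + B ^ p) / 2) :
    W ≤ (A ^ 2 + B ^ 2) / 2 := by
  refine (Real.rpow_le_rpow_iff hW (by positivity) (half_pos hp)).1 (h.trans ?_)
  simp only [← sq_rpow_half hA, ← sq_rpow_half hB]
  have hconc := (Real.concaveOn_rpow (half_pos hp).le (by linarith : p / 2 ≤ 1)).2
    (Set.mem_Ici.2 (sq_nonneg A)) (Set.mem_Ici.2 (sq_nonneg B))
    (by norm_num : (0 : ℝ) ≤ 1 / 2) (by norm_num : (0 : ℝ) ≤ 1 / 2) (by norm_num)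
  simp only [smul_eq_mul] at hconc
  calc _ = 1 / 2 * (A ^ 2) ^ (p / 2) + 1 / 2 * (B ^ 2) ^ (p / 2) := by ring
    _ ≤ _ := hconc
    _ = _ := by ring_nf

/-! ### Uniform convexity of `L_p` -/

/-- Uniform convexity of the norm with power type `q` and constant `c`, as a two-point
inequality. -/
def IsUniformlyConvexWith (E : Type*) [NormedAddCommGroup E] (q c : ℝ) : Prop :=
  ∀ x y : E, ‖x‖ ^ q + c * ‖y‖ ^ q ≤ (‖x + y‖ ^ q + ‖x - y‖ ^ q) / 2

section Lp

open MeasureTheory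

variable {α : Type*} [MeasurableSpace α] {μ : Measure α} {p : ℝ}

theorem Lp_integrable_rpow (hp : 0 < p) (f : Lp ℝ (ENNReal.ofReal p) μ) :
    Integrable (fun a => |f a| ^ p) μ := by
  have := (Lp.memLp f).integrable_norm_rpow (by simpa using hp) ENNReal.ofReal_ne_top
  simpa [ENNReal.toReal_ofReal hp.le] using this

theorem Lp_norm_rpow (hp : 0 < p) (f : Lp ℝ (ENNReal.ofReal p) μ) :
    ‖f‖ ^ p = ∫ a, |f a| ^ p ∂μ := by
  have h := (Lp.memLp f).eLpNorm_eq_integral_rpow_norm (by simpa using hp) ENNReal.ofReal_ne_top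
  have h₀ : 0 ≤ ∫ a, |f a| ^ p ∂μ := integral_nonneg fun a => by positivity
  simp only [ENNReal.toReal_ofReal hp.le, Real.norm_eq_abs] at h
  rw [Lp.norm_def, h, ENNReal.toReal_ofReal (by positivity), Real.rpow_inv_rpow h₀ hp.ne']

theorem Lp_integral_mean (hp : 0 < p) (f g : Lp ℝ (ENNReal.ofReal p) μ) :
    Integrable (fun a => (|f a + g a| ^ p + |f a - g a| ^ p) / 2) μ ∧
    ∫ a, (|f a + g a| ^ p + |f a - g a| ^ p) / 2 ∂μ = (‖f + g‖ ^ p + ‖f - g‖ ^ p) / 2 := by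
  have hadd : (fun a => |(f + g) a| ^ p) =ᵐ[μ] fun a => |f a + g a| ^ p := by
    filter_upwards [Lp.coeFn_add f g] with a ha
    rw [ha, Pi.add_apply]
  have hsub : (fun a => |(f - g) a| ^ p) =ᵐ[μ] fun a => |f a - g a| ^ p := by
    filter_upwards [Lp.coeFn_sub f g] with a ha
    rw [ha, Pi.sub_apply]
  have hadd' := (Lp_integrable_rpow hp (f + g)).congr hadd
  have hsub' := (Lp_integrable_rpow hp (f - g)).congr hsub
  refine ⟨(hadd'.add hsub').div_const 2, ?_⟩
  rw [integral_div, integral_add hadd' hsub', Lp_norm_rpow hp, Lp_norm_rpow hp,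
    integral_congr_ae hadd, integral_congr_ae hsub]

theorem Lp_isUniformlyConvexWith_of_two_le [Fact (1 ≤ ENNReal.ofReal p)] (hp : 2 ≤ p) :
    IsUniformlyConvexWith (Lp ℝ (ENNReal.ofReal p) μ) p 1 := by
  intro f g
  have hp₀ : 0 < p := by linarith
  obtain ⟨hint, hmean⟩ := Lp_integral_mean hp₀ f g
  have hf := Lp_integrable_rpow hp₀ f
  have hg := Lp_integrable_rpow hp₀ g
  rw [one_mul, ← hmean, Lp_norm_rpow hp₀, Lp_norm_rpow hp₀, ← integral_add hf hg]
  exact integral_mono (hf.add hg) hint fun a => rpow_add_rpow_le_mean hp (f a) (g a)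

/- The reverse Minkowski inequality in `L_{p/2}` for `f²` and `g²`. -/
theorem Lp_rpow_norm_sq_add_norm_sq_le (hp : 0 < p) (hp' : p < 2)
    (f g : Lp ℝ (ENNReal.ofReal p) μ) {F : α → ℝ} (hF : Integrable F μ)
    (hle : ∀ᵐ a ∂μ, (f a ^ 2 + g a ^ 2) ^ (p / 2) ≤ F a) :
    (‖f‖ ^ 2 + ‖g‖ ^ 2) ^ (p / 2) ≤ ∫ a, F a ∂μ := by
  set W := ‖f‖ ^ 2 + ‖g‖ ^ 2
  have hnorm (u : Lp ℝ (ENNReal.ofReal p) μ) : 0 ≤ ‖u‖ := ENNReal.toReal_nonneg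
  rcases (by positivity : 0 ≤ W).eq_or_lt with hW | hW
  · rw [← hW, Real.zero_rpow (by positivity)]
    exact integral_nonneg_of_ae (hle.mono fun a ha => le_trans (by positivity) ha)
  have hf := (Lp_integrable_rpow hp f).mul_const (‖f‖ ^ (2 - p))
  have hg := (Lp_integrable_rpow hp g).mul_const (‖g‖ ^ (2 - p))
  have hmono : ∫ a, |f a| ^ p * ‖f‖ ^ (2 - p) + |g a| ^ p * ‖g‖ ^ (2 - p) ∂μ ≤
      ∫ a, F a * W ^ ((2 - p) / 2) ∂μ := by
    refine integral_mono_ae (hf.add hg) (hF.mul_const _) (hle.mono fun a ha => ?_)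
    have hholder := rpow_mul_add_rpow_mul_le hp hp' (abs_nonneg (f a)) (abs_nonneg (g a))
      (hnorm f) (hnorm g)
    rw [sq_abs, sq_abs] at hholder
    exact hholder.trans (mul_le_mul_of_nonneg_right ha (by positivity))
  have hsq (u : Lp ℝ (ENNReal.ofReal p) μ) : ‖u‖ ^ p * ‖u‖ ^ (2 - p) = ‖u‖ ^ 2 := by
    rw [← Real.rpow_add_of_nonneg (hnorm u) hp.le (by linarith), add_sub_cancel, Real.rpow_two]
  rw [integral_add hf hg, integral_mul_const, integral_mul_const, integral_mul_const,
    ← Lp_norm_rpow hp, ← Lp_norm_rpow hp, hsq, hsq] at hmono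
  refine le_of_mul_le_mul_right ?_ (Real.rpow_pos_of_pos hW ((2 - p) / 2))
  rwa [← Real.rpow_add hW, ← add_div, add_sub_cancel, div_self two_ne_zero, Real.rpow_one]

theorem Lp_isUniformlyConvexWith_of_lt_two [Fact (1 ≤ ENNReal.ofReal p)] (hp' : p < 2) :
    IsUniformlyConvexWith (Lp ℝ (ENNReal.ofReal p) μ) 2 ((p - 1) / 2) := by
  intro f g
  have hp : 1 ≤ p := ENNReal.one_le_ofReal.1 Fact.out
  have hp₀ : 0 < p := by linarith
  obtain ⟨hint, hmean⟩ := Lp_integral_mean hp₀ f g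
  set d := √((p - 1) / 2)
  have hd : d ^ 2 = (p - 1) / 2 := Real.sq_sqrt (by linarith)
  have hrpow : (‖f‖ ^ 2 + ‖d • g‖ ^ 2) ^ (p / 2) ≤ (‖f + g‖ ^ p + ‖f - g‖ ^ p) / 2 := by
    refine hmean ▸ Lp_rpow_norm_sq_add_norm_sq_le hp₀ hp' f (d • g) hint ?_
    filter_upwards [Lp.coeFn_smul d g] with a ha
    rw [ha, Pi.smul_apply, smul_eq_mul, mul_pow, hd]
    exact rpow_half_le_mean hp hp'.le (f a) (g a)
  have hsq := le_mean_sq_of_rpow_half_le hp₀ hp'.le (by positivity) (norm_nonneg (f + g))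
    (norm_nonneg (f - g)) hrpow
  rw [norm_smul, mul_pow, Real.norm_eq_abs, sq_abs, hd] at hsq
  simpa only [Real.rpow_two] using hsq

end Lp

/-! ### Uniformly convex spaces are Markov convex -/

section UniformlyConvex

variable {E : Type*} [NormedAddCommGroup E] {q c : ℝ}

theorem norm_sub_rpow_le (hq : 1 ≤ q) (u v : E) :
    2 / 2 ^ q * ‖u - v‖ ^ q ≤ ‖u‖ ^ q + ‖v‖ ^ q := by
  have h := (Real.rpow_le_rpow (by positivity)
    (div_le_div_of_nonneg_right (norm_sub_le u v) zero_le_two) (by linarith)).trans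
    (rpow_mean_le (norm_nonneg u) (norm_nonneg v) hq)
  rw [Real.div_rpow (norm_nonneg _) zero_le_two] at h
  linear_combination 2 * h

variable [NormedSpace ℝ E]

theorem IsUniformlyConvexWith.norm_rpow_add_le (h : IsUniformlyConvexWith E q c) (u v : E) :
    2 / 2 ^ q * (‖u + v‖ ^ q + c * ‖u - v‖ ^ q) ≤ ‖u‖ ^ q + ‖v‖ ^ q := by
  have hdouble (w : E) : ‖(2 : ℝ) • w‖ ^ q = 2 ^ q * ‖w‖ ^ q := by
    rw [norm_smul, Real.norm_ofNat, Real.mul_rpow zero_le_two (norm_nonneg w)]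
  have huv := h (u + v) (u - v)
  rw [add_add_sub_cancel, add_sub_sub_cancel, ← two_smul ℝ u, ← two_smul ℝ v, hdouble,
    hdouble] at huv
  rw [div_mul_eq_mul_div, div_le_iff₀ (by positivity)]
  linarith

theorem IsUniformlyConvexWith.four_point_le (h : IsUniformlyConvexWith E q c) (hq : 1 ≤ q)
    (hc : 0 ≤ c) (x y z w : E) :
    2 / 2 ^ q * (‖x - z‖ ^ q + ‖x - w‖ ^ q) + c * (2 / 2 ^ q) ^ 2 * ‖z - w‖ ^ q ≤
      ‖y - z‖ ^ q + ‖y - w‖ ^ q + 2 * ‖x - y‖ ^ q := by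
  have hz := h.norm_rpow_add_le (x - y) (y - z)
  have hw := h.norm_rpow_add_le (x - y) (y - w)
  have hzw := norm_sub_rpow_le hq (x - y - (y - z)) (x - y - (y - w))
  rw [show x - y - (y - z) - (x - y - (y - w)) = z - w by abel] at hzw
  rw [sub_add_sub_cancel] at hz hw
  have hk : 0 ≤ c * (2 / 2 ^ q) := by positivity
  linarith [mul_le_mul_of_nonneg_left hzw hk]

theorem IsUniformlyConvexWith.isForkConvex (h : IsUniformlyConvexWith E q c) (hq : 1 ≤ q)
    (hc : 0 ≤ c) : IsForkConvex E q (ENNReal.ofReal (c * (2 / 2 ^ q) ^ 2)) := by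
  intro x y z w
  have hq₀ : 0 ≤ q := by linarith
  have hedist (u v : E) : edist u v ^ q = ENNReal.ofReal (‖u - v‖ ^ q) := by
    rw [edist_dist, dist_eq_norm, ENNReal.ofReal_rpow_of_nonneg (norm_nonneg _) hq₀]
  have hcoeff : 2 / (2 : ℝ≥0∞) ^ q = ENNReal.ofReal (2 / 2 ^ q) := by
    rw [ENNReal.ofReal_div_of_pos (by positivity), ← ENNReal.ofReal_rpow_of_pos two_pos,
      ENNReal.ofReal_ofNat]
  have htwo : (2 : ℝ≥0∞) * ENNReal.ofReal (‖x - y‖ ^ q) = ENNReal.ofReal (2 * ‖x - y‖ ^ q) := by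
    rw [ENNReal.ofReal_mul zero_le_two, ENNReal.ofReal_ofNat]
  have := ENNReal.ofReal_le_ofReal (h.four_point_le hq hc x y z w)
  simp only [hedist, hcoeff, htwo]
  rwa [← ENNReal.ofReal_add (by positivity) (by positivity), ← ENNReal.ofReal_mul (by positivity),
    ← ENNReal.ofReal_mul (by positivity), ← ENNReal.ofReal_add (by positivity) (by positivity),
    ← ENNReal.ofReal_add (by positivity) (by positivity),
    ← ENNReal.ofReal_add (by positivity) (by positivity)]

theorem IsUniformlyConvexWith.exists_isMarkovConvexWith (h : IsUniformlyConvexWith E q c)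
    (hq : 1 ≤ q) (hc : 0 < c) : ∃ C : ℝ≥0, 0 < C ∧ IsMarkovConvexWith E q C := by
  have hc' : 0 < (c * (2 / 2 ^ q) ^ 2).toNNReal := Real.toNNReal_pos.2 (by positivity)
  exact ⟨_, by positivity, (h.isForkConvex hq hc.le).isMarkovConvexWith (by linarith) hc'⟩

end UniformlyConvex

theorem exists_Lp_isMarkovConvexWith {α : Type*} [MeasurableSpace α] (μ : MeasureTheory.Measure α)
    {p : ℝ} (hp : 1 < p) : ∃ C : ℝ≥0, 0 < C ∧
      IsMarkovConvexWith (MeasureTheory.Lp ℝ (ENNReal.ofReal p) μ) (max 2 p) C := by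
  have : Fact (1 ≤ ENNReal.ofReal p) := ⟨by simpa using hp.le⟩
  rcases le_or_gt 2 p with h | h
  · rw [max_eq_right h]
    exact (Lp_isUniformlyConvexWith_of_two_le h).exists_isMarkovConvexWith hp.le one_pos
  · rw [max_eq_left h.le]
    exact (Lp_isUniformlyConvexWith_of_lt_two h).exists_isMarkovConvexWith one_le_two
      (by linarith)

theorem exists_mul_markovConvexity_le_lpDistortion {p : ℝ} (hp : 1 < p) : ∃ κ : ℝ≥0, 0 < κ ∧
    ∀ (X : Type*) [MetricSpace X],
      (κ : ℝ≥0∞) * markovConvexity (max 2 p) X ≤ lpDistortion p X := by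
  have : Fact (1 ≤ ENNReal.ofReal p) := ⟨by simpa using hp.le⟩
  obtain ⟨C, hC, hL⟩ := exists_Lp_isMarkovConvexWith
    (MeasureTheory.volume.restrict (Set.Icc (0 : ℝ) 1)) hp
  refine ⟨C⁻¹, inv_pos.2 hC, fun X _ => ?_⟩
  have h := markovConvexity_le_mul_distortion (X := X) (zero_le_two.trans (le_max_left 2 p)) hC hL
  rw [ENNReal.coe_inv hC.ne', mul_comm, ← div_eq_mul_inv]
  exact ENNReal.div_le_of_le_mul' h

/-! ### The random descent -/

namespace SST

variable {s : List ℕ} {h : ℕ}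

/-- One step of the random descent: a uniformly random child, or the vertex itself at a leaf. -/
def descend (v : SST s) : PMF (SST s) :=
  if hv : 0 < s.getD v.1.length 0 then
    have : Nonempty (Fin (s.getD v.1.length 0)) := ⟨⟨0, hv⟩⟩
    (PMF.uniformOfFintype (Fin (s.getD v.1.length 0))).map
      fun a : Fin (s.getD v.1.length 0) => v.snoc a a.2
  else PMF.pure v

theorem prefix_of_mem_support_descend (hs : HasHeight s h) {v w : SST s}
    (hw : w ∈ (descend v).support) : v.1 <+: w.1 ∧ w.1.length = min (v.1.length + 1) h := by
  have hle := length_le_of_hasHeight hs v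
  rw [descend] at hw
  split_ifs at hw with hv <;> rw [hs] at hv
  · obtain ⟨a, -, rfl⟩ := (PMF.mem_support_map_iff _ _ _).1 hw
    refine ⟨List.prefix_append _ _, ?_⟩
    simp only [val_snoc, List.length_append, List.length_singleton]
    lia
  · obtain rfl := (PMF.mem_support_pure_iff _ _).1 hw
    exact ⟨List.prefix_rfl, by lia⟩

theorem prefix_of_mem_support_chainLaw (hs : HasHeight s h) {v w : SST s} {n : ℕ}
    (hw : w ∈ (chainLaw (PMF.pure v) descend n).support) :
    v.1 <+: w.1 ∧ w.1.length = min (v.1.length + n) h := by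
  induction n generalizing w with
  | zero =>
    obtain rfl := (PMF.mem_support_pure_iff _ _).1 hw
    exact ⟨List.prefix_rfl, by simpa using length_le_of_hasHeight hs w⟩
  | succ n ih =>
    obtain ⟨u, hu, hw⟩ := (PMF.mem_support_bind_iff _ _ _).1 hw
    obtain ⟨hvu, hlen⟩ := ih hu
    obtain ⟨huw, hlen'⟩ := prefix_of_mem_support_descend hs hw
    exact ⟨hvu.trans huw, by lia⟩

theorem inv_two_le_expect_uniformOfFintype {d : ℕ} [Nonempty (Fin d)] (hd : 2 ≤ d)
    (o : Option ℕ) :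
    2⁻¹ ≤ expect (PMF.uniformOfFintype (Fin d)) fun a => if some (a : ℕ) = o then 0 else 1 := by
  have hsum : expect (PMF.uniformOfFintype (Fin d)) (fun a => if some (a : ℕ) = o then 0 else 1) =
      (Finset.card {a : Fin d | some (a : ℕ) ≠ o} : ℝ≥0∞) / d := by
    simp only [expect, tsum_fintype, PMF.uniformOfFintype_apply, Fintype.card_fin,
      ← Finset.mul_sum, ← ite_not (some _ = o), Finset.sum_boole, ENNReal.div_eq_inv_mul, ne_eq]
  have hone : Finset.card {a : Fin d | some (a : ℕ) = o} ≤ 1 :=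
    Finset.card_le_one.2 fun a ha b hb => by
      rw [Finset.mem_filter_univ] at ha hb
      exact Fin.ext (Option.some_injective _ (ha.trans hb.symm))
  have hcard := Finset.card_filter_add_card_filter_not (s := Finset.univ)
    fun a : Fin d => some (a : ℕ) = o
  rw [Finset.card_fin] at hcard
  rw [hsum, ENNReal.le_div_iff_mul_le (.inl (by simp; lia)) (.inl (by simp)),
    ENNReal.inv_mul_le_iff (by simp) (by simp)]
  exact_mod_cast (by lia)

theorem inv_two_le_expect_descend {v : SST s} (hv : IsBranchLevel s v.1.length) (o : Option ℕ) :
    2⁻¹ ≤ expect (descend v) fun w => if w.1[v.1.length]? = o then 0 else 1 := by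
  rw [descend, dif_pos (two_pos.trans_le hv), expect_map]
  have : Nonempty (Fin (s.getD v.1.length 0)) := ⟨⟨0, two_pos.trans_le hv⟩⟩
  simpa using inv_two_le_expect_uniformOfFintype hv o

theorem inv_two_le_expect_chainLaw (hs : HasHeight s h) {v : SST s} {a n : ℕ}
    (ha : IsBranchLevel s a) (hva : v.1.length ≤ a) (han : a < v.1.length + n) (o : Option ℕ) :
    2⁻¹ ≤ expect (chainLaw (PMF.pure v) descend n) fun y => if y.1[a]? = o then 0 else 1 := by
  have hah := ha.lt hs
  obtain ⟨r, rfl⟩ : ∃ r, n = a - v.1.length + (r + 1) := ⟨n - (a - v.1.length) - 1, by lia⟩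
  rw [chainLaw_add, expect_bind, ← expect_const (chainLaw (PMF.pure v) descend _) 2⁻¹]
  refine expect_mono _ fun u hu => ?_
  obtain rfl : u.1.length = a := by
    have := (prefix_of_mem_support_chainLaw hs hu).2
    lia
  rw [chainLaw_pure_succ, expect_bind]
  refine (inv_two_le_expect_descend ha o).trans (expect_mono _ fun w hw => ?_)
  have hlen := (prefix_of_mem_support_descend hs hw).2
  rw [← expect_const (chainLaw (PMF.pure w) descend r)
    (if w.1[u.1.length]? = o then 0 else 1)]
  refine expect_mono _ fun y hy => le_of_eq ?_
  obtain ⟨x, hx⟩ := (prefix_of_mem_support_chainLaw hs hy).1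
  rw [← hx, List.getElem?_append_left (by lia)]

/- Two independent descents choose different children at the branch level `a` with probability at
least `1 / 2`. -/
theorem le_expect_edist (hs : HasHeight s h) {p : ℝ} (hp : 0 ≤ p) {v : SST s} {a n R : ℕ}
    (ha : IsBranchLevel s a) (hva : v.1.length ≤ a) (hn : v.1.length + n ≤ h)
    (hR : R + 2 * a ≤ 2 * (v.1.length + n)) (hR' : 0 < R) :
    2⁻¹ * (R : ℝ≥0∞) ^ p ≤ expect (chainLaw (PMF.pure v) descend n) fun y =>
      expect (chainLaw (PMF.pure v) descend n) fun z => edist y z ^ p := by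
  have hmem {y : SST s} (hy : y ∈ (chainLaw (PMF.pure v) descend n).support) :
      y.1.length = v.1.length + n := by
    rw [(prefix_of_mem_support_chainLaw hs hy).2, min_eq_left hn]
  rw [← expect_const (chainLaw (PMF.pure v) descend n) (2⁻¹ * _)]
  refine expect_mono _ fun y hy => ?_
  calc 2⁻¹ * (R : ℝ≥0∞) ^ p
      ≤ (R : ℝ≥0∞) ^ p * expect (chainLaw (PMF.pure v) descend n)
          (fun z => if z.1[a]? = y.1[a]? then 0 else 1) := by
        rw [mul_comm]
        gcongr
        exact inv_two_le_expect_chainLaw hs ha hva (by lia) _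
    _ = expect (chainLaw (PMF.pure v) descend n)
          (fun z => (R : ℝ≥0∞) ^ p * if z.1[a]? = y.1[a]? then 0 else 1) :=
        (expect_const_mul _ _ _).symm
    _ ≤ _ := expect_mono _ fun z hz => ?_
  split_ifs with hyz
  · simp
  · have hdist := le_wordDist_of_getElem?_ne (Ne.symm hyz)
    rw [hmem hy, hmem hz] at hdist
    rw [mul_one, edist_eq]
    exact ENNReal.rpow_le_rpow (by exact_mod_cast (by lia)) hp

theorem expect_stepLaw_descend_le (hs : HasHeight s h) {p : ℝ} (hp : 0 < p) (t : ℕ) :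
    expect (stepLaw (PMF.pure (root s)) descend t) (fun z => edist z.2 z.1 ^ p) ≤
      if t < h then 1 else 0 := by
  rw [expect_stepLaw, pairExpect, Nat.add_sub_cancel_left]
  rw [← expect_const (chainLaw (PMF.pure (root s)) descend t) (if t < h then 1 else 0)]
  refine expect_mono _ fun v hv => ?_
  rw [← expect_const (chainLaw (PMF.pure v) descend 1) (if t < h then 1 else 0)]
  refine expect_mono _ fun w hw => ?_
  have hlen := (prefix_of_mem_support_chainLaw hs hv).2
  obtain ⟨hpre, hlen'⟩ := prefix_of_mem_support_chainLaw hs hw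
  rw [show (root s).1.length = 0 from rfl, zero_add] at hlen
  rw [edist_comm, edist_eq, wordDist_of_isPrefix hpre, hlen', hlen]
  split_ifs with ht
  · rw [show min (min t h + 1) h - min t h = 1 by lia]
    simp
  · rw [show min (min t h + 1) h - min t h = 0 by lia]
    simp [hp]

theorem sum_expect_stepLaw_descend_le (hs : HasHeight s h) {p : ℝ} (hp : 0 < p) (N : ℕ) :
    ∑ t ∈ Finset.Icc 1 N, expect (stepLaw (PMF.pure (root s)) descend (t - 1))
      (fun z => edist z.2 z.1 ^ p) ≤ h := by
  calc _ ≤ ∑ t ∈ Finset.Icc 1 N, if t - 1 < h then (1 : ℝ≥0∞) else 0 :=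
        Finset.sum_le_sum fun t _ => expect_stepLaw_descend_le hs hp (t - 1)
    _ = (({t ∈ Finset.Icc 1 N | t - 1 < h}.card : ℕ) : ℝ≥0∞) := by rw [Finset.sum_boole]
    _ ≤ h := by
        have hsub : {t ∈ Finset.Icc 1 N | t - 1 < h} ⊆ Finset.Icc 1 h := fun t ht => by
          simp only [Finset.mem_filter, Finset.mem_Icc] at ht ⊢
          lia
        exact_mod_cast (Finset.card_le_card hsub).trans_eq (by simp)

theorem card_splitTimes_le_sum_expect (hs : HasHeight s h) {p : ℝ} (hp : 0 ≤ p) {N : ℕ}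
    (hN : h ≤ N) (k : ℕ) :
    2⁻¹ * ((splitTimes s h k).card : ℝ≥0∞) ≤ ∑ t ∈ Finset.Icc 1 N,
      expect (splitLaw (PMF.pure (root s)) descend (t - 2 ^ (k + 1)) t)
        (fun z => edist z.1 z.2 ^ p) / (2 : ℝ≥0∞) ^ (((k + 1 : ℕ) : ℝ) * p) := by
  have hsub : splitTimes s h k ⊆ Finset.Icc 1 N := fun t ht =>
    Finset.Icc_subset_Icc_right hN (mem_splitTimes.1 ht).1
  refine le_trans ?_ (Finset.sum_le_sum_of_subset hsub)
  rw [mul_comm, ← nsmul_eq_mul, ← Finset.sum_const]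
  refine Finset.sum_le_sum fun t ht => ?_
  obtain ⟨ht, a, ha, hat, hta⟩ := mem_splitTimes.1 ht
  have hth := (Finset.mem_Icc.1 ht).2
  have hpos := Nat.two_pow_pos k
  have hpow : (2 : ℝ≥0∞) ^ (((k + 1 : ℕ) : ℝ) * p) = ((2 ^ (k + 1) : ℕ) : ℝ≥0∞) ^ p := by
    rw [ENNReal.rpow_mul, ENNReal.rpow_natCast]
    norm_cast
  rw [ENNReal.le_div_iff_mul_le (.inl (by simp)) (.inl (by simp)), hpow, expect_splitLaw,
    ← expect_const (chainLaw (PMF.pure (root s)) descend (t - 2 ^ (k + 1))) (2⁻¹ * _)]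
  refine expect_mono _ fun v hv => ?_
  have hlen := (prefix_of_mem_support_chainLaw hs hv).2
  rw [show (root s).1.length = 0 from rfl, zero_add] at hlen
  rw [pow_succ] at hlen hta ⊢
  exact le_expect_edist hs hp ha (by lia) (by lia) (by lia) (by lia)

end SST

theorem IsMarkovConvexWith.sum_card_splitTimes_le {s : List ℕ} {h : ℕ} (hs : HasHeight s h)
    {p : ℝ} (hp : 0 < p) {C : ℝ≥0} (hC : IsMarkovConvexWith (SST s) p C) {n : ℕ} (hn : n ≤ h) :
    2⁻¹ * ((∑ k ∈ Finset.range n, (splitTimes s h k).card : ℕ) : ℝ≥0∞) ≤ (C : ℝ≥0∞) ^ p * h := by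
  have hconvex := hC (SST s) (PMF.pure (SST.root s)) SST.descend id h
  rw [Finset.sum_range_succ'] at hconvex
  push_cast
  rw [Finset.mul_sum]
  calc ∑ k ∈ Finset.range n, 2⁻¹ * ((splitTimes s h k).card : ℝ≥0∞)
      ≤ ∑ k ∈ Finset.range h, 2⁻¹ * ((splitTimes s h k).card : ℝ≥0∞) :=
        Finset.sum_le_sum_of_subset (Finset.range_mono hn)
    _ ≤ _ := Finset.sum_le_sum fun k _ =>
        SST.card_splitTimes_le_sum_expect hs hp.le Nat.lt_two_pow_self.le k
    _ ≤ _ := le_self_add.trans hconvex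
    _ ≤ (C : ℝ≥0∞) ^ p * h :=
        mul_le_mul_right (SST.sum_expect_stepLaw_descend_le hs hp _) _

theorem le_markovConvexity_cantor {p : ℝ} (hp : 0 < p) (i : ℕ) :
    (((1 / 8 : ℝ≥0) : ℝ≥0∞) * i) ^ (1 / p) ≤ markovConvexity p (Cantor i) := by
  refine le_iInf₂ fun C hC => ?_
  have hsum := hC.sum_card_splitTimes_le (hasHeight_cantorDegrees i) hp (le_height i)
  rw [one_div p, ENNReal.rpow_inv_le_iff hp]
  rcases Nat.eq_zero_or_pos i with rfl | hi
  · simp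
  have hcount := mul_height_le_sum_card_splitTimes i
  have hpos := hi.trans_le (le_height i)
  generalize ∑ k ∈ Finset.range i, (splitTimes (cantorDegrees i) (height i) k).card = S at *
  rw [← ENNReal.coe_rpow_of_nonneg _ hp.le, ← ENNReal.coe_inv_two] at hsum
  rw [← ENNReal.coe_rpow_of_nonneg _ hp.le]
  generalize C ^ p = D at *
  have hsum : 2⁻¹ * (S : ℝ≥0) ≤ D * height i := by exact_mod_cast hsum
  have hcount : (i : ℝ≥0) * height i ≤ 4 * S := by exact_mod_cast hcount
  have hpos : (0 : ℝ≥0) < height i := by exact_mod_cast hpos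
  suffices (1 / 8 : ℝ≥0) * i ≤ D by exact_mod_cast this
  refine le_of_mul_le_mul_right ?_ hpos
  calc (1 / 8 : ℝ≥0) * i * height i = 8⁻¹ * (i * height i) := by ring
    _ ≤ 8⁻¹ * (4 * S) := by gcongr
    _ = 2⁻¹ * S := by ring
    _ ≤ D * height i := hsum

/-! ### Binary trees in Cantor trees -/

theorem wordDist_comm (l l' : List ℕ) : wordDist l l' = wordDist l' l := by
  fun_induction wordDist l l' with
  | case1 l' => cases l' <;> simp [wordDist]
  | case2 => simp [wordDist]
  | case3 => simp_all [wordDist]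
  | case4 => grind [wordDist]

theorem length_le_wordDist_add_length {w l l' : List ℕ} (h : w <+: l) (h' : ¬ w <+: l') :
    l.length ≤ wordDist l l' + w.length := by
  obtain ⟨u, x, y, rfl, rfl, hd⟩ := exists_wordDist_eq l l'
  have : u.length < w.length := by
    by_contra! hlt
    exact h' ((List.prefix_of_prefix_length_le h (List.prefix_append u x) hlt).trans
      (List.prefix_append u y))
  simp only [List.length_append]
  lia

theorem wordDist_add_two_mul_length_le {w l l' : List ℕ} (h : w <+: l) (h' : w <+: l') :
    wordDist l l' + 2 * w.length ≤ l.length + l'.length := by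
  obtain ⟨x, rfl⟩ := h
  obtain ⟨y, rfl⟩ := h'
  obtain ⟨u, x, y, rfl, rfl, hd⟩ := exists_wordDist_eq x y
  rw [wordDist_append_append, hd]
  simp only [List.length_append]
  lia

namespace SST

variable {s s' : List ℕ} {h : ℕ}

theorem dist_root (v : SST s) : dist (root s) v = v.1.length :=
  congrArg Nat.cast (graph_dist_root v)

theorem abs_length_sub_length_le_dist (u v : SST s) :
    |(u.1.length : ℝ) - v.1.length| ≤ dist u v := by
  rw [← dist_root, ← dist_root, dist_comm _ u, dist_comm _ v]
  exact abs_dist_sub_le u v (root s)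

theorem dist_le_length_add_length (u v : SST s) : dist u v ≤ u.1.length + v.1.length := by
  rw [← dist_root u, ← dist_root v]
  exact dist_triangle_left u v (root s)

theorem dist_le_of_isPrefix_of_not_isPrefix {p u v : SST s} (hu : p.1 <+: u.1)
    (hv : ¬ p.1 <+: v.1) : dist p u ≤ dist u v := by
  rw [dist_eq, dist_eq, wordDist_of_isPrefix hu, Nat.cast_le]
  have := length_le_wordDist_add_length hu hv
  lia

theorem one_le_dist {u v : SST s} (huv : u ≠ v) : 1 ≤ dist u v := by
  have hpos := dist_pos.2 huv
  rw [dist_eq] at hpos ⊢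
  exact_mod_cast hpos

theorem dist_root_leftmost (hs : HasHeight s h) {n : ℕ} (hn : n ≤ h) :
    dist (root s) (leftmost hs n hn) = n := by
  rw [dist_root, length_leftmost]

theorem length_lt_of_dist_lt {p u : SST s} {y N : ℕ} (hp : p.1.length = y + N)
    (hu : dist p u < N) : y < u.1.length ∧ u.1.length < y + 2 * N := by
  have hlt := (abs_length_sub_length_le_dist p u).trans_lt hu
  rw [hp, abs_lt] at hlt
  push_cast at hlt
  constructor
  · exact_mod_cast (by linarith : (y : ℝ) < u.1.length)
  · exact_mod_cast (by linarith : (u.1.length : ℝ) < y + 2 * N)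

theorem prefix_of_not_isBranchLevel {y N : ℕ}
    (hwindow : ∀ z, y < z → z < y + 2 * N → ¬ IsBranchLevel s z) {p u v : SST s}
    (hp : p.1.length = y + N) (hu : dist p u < N) (hv : dist p v < N)
    (huv : u.1.length ≤ v.1.length) : u.1 <+: v.1 := by
  have hagree {u : SST s} (hu : dist p u < N) {z : ℕ} (hz : z ≤ y) : p.1[z]? = u.1[z]? := by
    by_contra hne
    have := (length_lt_of_dist_lt hp hu).1
    have := le_wordDist_of_getElem?_ne hne
    rw [dist_eq, Nat.cast_lt] at hu
    lia
  rw [List.prefix_iff_getElem?]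
  intro z hz
  rcases le_or_gt z y with hzy | hyz
  · rw [← hagree hv hzy, hagree hu hzy, List.getElem?_eq_getElem hz]
  · have hv' := (length_lt_of_dist_lt hp hv).2
    have hdeg : s.getD z 0 < 2 := not_le.1 (hwindow z hyz (by lia))
    have := u.2 z hz
    have := v.2 z (by lia)
    rw [List.getElem?_eq_getElem (by lia)]
    congr 1
    lia

theorem dist_eq_of_not_isBranchLevel {y N : ℕ}
    (hwindow : ∀ z, y < z → z < y + 2 * N → ¬ IsBranchLevel s z) {p u v : SST s}
    (hp : p.1.length = y + N) (hu : dist p u < N) (hv : dist p v < N) :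
    dist u v = |(u.1.length : ℝ) - v.1.length| := by
  wlog huv : u.1.length ≤ v.1.length generalizing u v
  · rw [dist_comm, abs_sub_comm]
    exact this hv hu (le_of_not_ge huv)
  rw [dist_eq, wordDist_of_isPrefix (prefix_of_not_isBranchLevel hwindow hp hu hv huv),
    Nat.cast_sub huv, abs_sub_comm, abs_of_nonneg (by simpa using huv)]

theorem two_pow_le_ncard_closedBall (hs : HasHeight s h) (hbranch : ∀ j < h, IsBranchLevel s j)
    {q : ℕ} (hq : q ≤ h) (v : SST s) : 2 ^ q ≤ (Metric.closedBall v (2 * q)).ncard := by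
  have hv := length_le_of_hasHeight hs v
  set u := v.take (h - q)
  have hu : u.1.length = min (h - q) v.1.length := by simp [u]
  have hvu : dist u v ≤ q := by
    rw [dist_eq, wordDist_of_isPrefix (l := u.1) (List.take_prefix _ _), Nat.cast_le]
    lia
  let G (x : Fin q → Fin 2) : SST s := ⟨u.1 ++ List.ofFn fun j => (x j : ℕ), fun j hj => by
    rw [List.length_append, List.length_ofFn] at hj
    rcases lt_or_ge j u.1.length with hlt | hge
    · rw [List.getElem_append_left hlt]
      exact u.2 j hlt
    · rw [List.getElem_append_right hge, List.getElem_ofFn]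
      exact (x _).2.trans_le (hbranch j (by lia))⟩
  have hG : Function.Injective G := fun x x' hx => by
    have := congrArg Subtype.val hx
    simp only [G, List.append_cancel_left_eq, List.ofFn_inj] at this
    exact funext fun j => Fin.ext (congrFun this j)
  have hball (x : Fin q → Fin 2) : G x ∈ Metric.closedBall v (2 * q) := by
    have huG : dist (G x) u ≤ q := by
      rw [dist_comm, dist_eq, wordDist_of_isPrefix (List.prefix_append _ _)]
      simp
    exact (dist_triangle _ u v).trans (by linarith)
  calc 2 ^ q = (Set.range G).ncard := by
        rw [← Set.image_univ, Set.ncard_image_of_injective _ hG, Set.ncard_univ]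
        simp
    _ ≤ (Metric.closedBall v (2 * q)).ncard :=
        Set.ncard_le_ncard (Set.range_subset_iff.2 hball)

theorem exists_dist_map_le {f : SST s → SST s'} {A : ℝ≥0} (hf : LipschitzWith A f)
    {p : SST s'} {v w : SST s} (hv : p.1 <+: (f v).1) (hw : ¬ p.1 <+: (f w).1) :
    ∃ x, dist p (f x) ≤ A := by
  obtain ⟨W⟩ := (connected s).preconnected v w
  obtain ⟨d, -, hfst, hsnd⟩ := W.exists_boundary_dart {x | p.1 <+: (f x).1} hv hw
  refine ⟨d.fst, (dist_le_of_isPrefix_of_not_isPrefix hfst hsnd).trans ?_⟩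
  have hd : dist d.fst d.snd = 1 :=
    congrArg Nat.cast (SimpleGraph.dist_eq_one_iff_adj.2 d.adj) |>.trans Nat.cast_one
  simpa [hd] using hf.dist_le_mul d.fst d.snd

end SST

theorem ncard_le_of_one_le_abs_sub {ι : Type*} {S : Set ι} {φ : ι → ℝ} {a b : ℝ} (hab : a ≤ b)
    (hsep : ∀ x ∈ S, ∀ y ∈ S, x ≠ y → 1 ≤ |φ x - φ y|) (hφ : ∀ x ∈ S, φ x ∈ Set.Icc a b) :
    (S.ncard : ℝ) ≤ b - a + 2 := by
  have hinj : Set.InjOn (fun x => ⌊φ x⌋) S := fun x hx y hy hxy => by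
    by_contra hne
    exact (hsep x hx y hy hne).not_gt (Int.abs_sub_lt_one_of_floor_eq_floor hxy)
  have hmaps : ∀ x ∈ S, ⌊φ x⌋ ∈ (Finset.Icc ⌊a⌋ ⌊b⌋ : Set ℤ) := fun x hx => by
    rw [Finset.coe_Icc]
    exact ⟨Int.floor_le_floor (hφ x hx).1, Int.floor_le_floor (hφ x hx).2⟩
  have hcard := Set.ncard_le_ncard_of_injOn _ hmaps hinj (Finset.finite_toSet _)
  rw [Set.ncard_coe_finset, Int.card_Icc] at hcard
  have hfloor : ⌊a⌋ ≤ ⌊b⌋ := Int.floor_le_floor hab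
  have hcard' : (S.ncard : ℝ) ≤ ⌊b⌋ + 1 - ⌊a⌋ := by exact_mod_cast (by lia)
  linarith [Int.floor_le b, Int.lt_floor_add_one a]

theorem exists_lt_two_pow (c : ℝ≥0) : ∃ q : ℕ, 2 * ((c : ℝ) * (2 * q + 1)) + 2 < 2 ^ q := by
  obtain ⟨n, hn⟩ := exists_nat_ge (8 * (c : ℝ) + 4)
  have hn' : (n : ℝ) + 1 ≤ 2 ^ n := by exact_mod_cast Nat.lt_two_pow_self (n := n)
  refine ⟨2 * n, ?_⟩
  calc 2 * ((c : ℝ) * (2 * (2 * n : ℕ) + 1)) + 2 < ((n : ℝ) + 1) * (n + 1) := by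
        push_cast
        nlinarith [c.coe_nonneg]
    _ ≤ 2 ^ n * 2 ^ n := by gcongr
    _ = 2 ^ (2 * n) := by ring

/- Otherwise the image of a ball with exponentially many points would lie in a segment whose length
is linear in the radius of the ball. -/
theorem SST.prefix_map_of_prefix_map {s s' : List ℕ} {h q N y : ℕ} {A B : ℝ≥0}
    (hs : HasHeight s h) (hbranch : ∀ j < h, IsBranchLevel s j) (hq : q ≤ h)
    {f : SST s → SST s'} (hA : LipschitzWith A f) (hB : AntilipschitzWith B f)
    (hAB : 2 * ((A * B : ℝ≥0) * (2 * q + 1) : ℝ) + 2 < 2 ^ q) (hN : (A : ℝ) * (2 * q + 1) < N)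
    (hwindow : ∀ z, y < z → z < y + 2 * N → ¬ IsBranchLevel s' z) {p : SST s'}
    (hp : p.1.length = y + N) {v w : SST s} (hv : p.1 <+: (f v).1) : p.1 <+: (f w).1 := by
  by_contra hw
  obtain ⟨u, hu⟩ := exists_dist_map_le hA hv hw
  have hclose {x : SST s} (hx : x ∈ Metric.closedBall u (2 * q)) :
      dist p (f x) ≤ A * (2 * q + 1) := by
    calc dist p (f x) ≤ dist p (f u) + dist (f u) (f x) := dist_triangle _ _ _
      _ ≤ A + A * (2 * q) := add_le_add hu <| (hA.dist_le_mul u x).trans <| by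
          gcongr
          exact Metric.mem_closedBall'.1 hx
      _ = A * (2 * q + 1) := by ring
  have hcard := ncard_le_of_one_le_abs_sub (S := Metric.closedBall u (2 * q))
    (φ := fun x => B * ((f x).1.length : ℝ)) (a := B * (p.1.length - A * (2 * q + 1)))
    (b := B * (p.1.length + A * (2 * q + 1)))
    (mul_le_mul_of_nonneg_left (by linarith [show 0 ≤ (A : ℝ) * (2 * q + 1) by positivity])
      B.coe_nonneg)
    (fun x hx x' hx' hne => by
      rw [← mul_sub, abs_mul, NNReal.abs_eq, ← dist_eq_of_not_isBranchLevel hwindow hp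
        ((hclose hx).trans_lt hN) ((hclose hx').trans_lt hN)]
      exact (one_le_dist hne).trans (hB.le_mul_dist x x'))
    fun x hx => by
      have := abs_le.1 ((abs_length_sub_length_le_dist p (f x)).trans (hclose hx))
      constructor <;> gcongr <;> linarith
  have hball : (2 : ℝ) ^ q ≤ (Metric.closedBall u (2 * q)).ncard := by
    exact_mod_cast two_pow_le_ncard_closedBall hs hbranch hq u
  push_cast at hAB
  linarith

theorem getD_binaryTree {k j : ℕ} :
    (List.replicate k 2 ++ [0]).getD j 0 = if j < k then 2 else 0 := by
  split_ifs with hj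
  · rw [List.getD_append _ _ _ _ (by simpa using hj), List.getD_replicate _ hj]
  · rw [List.getD_append_right _ _ _ _ (by simpa using not_lt.1 hj)]
    cases j - (List.replicate k 2).length <;> rfl

theorem hasHeight_binaryTree (k : ℕ) : HasHeight (List.replicate k 2 ++ [0]) k := fun j => by
  rw [getD_binaryTree]
  split_ifs <;> simp_all

theorem isBranchLevel_binaryTree {k j : ℕ} (hj : j < k) :
    IsBranchLevel (List.replicate k 2 ++ [0]) j := by
  rw [IsBranchLevel, getD_binaryTree, if_pos hj]

section Embedding

variable {k i q j : ℕ} {A B : ℝ≥0} {f : BinaryTree k → Cantor i}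

theorem length_lt_of_embedding (hA : LipschitzWith A f) (hB : AntilipschitzWith B f) (hq : q ≤ k)
    (hAB : 2 * ((A * B : ℝ≥0) * (2 * q + 1) : ℝ) + 2 < 2 ^ q)
    (hj : (A : ℝ) * (2 * q + 1) < 2 ^ j) {v w : BinaryTree k} {n a b : ℕ}
    (hv : (f v).1.length = n + a) (hw : (f w).1.length = n + b)
    (hd : wordDist (f v).1 (f w).1 = a + b) : a < height (j + 1) + 2 * 2 ^ (j + 1) := by
  by_contra! hlong
  obtain ⟨z, hlz, hzx, hwindow⟩ := exists_interval_not_isBranchLevel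
    (SST.length_le_of_hasHeight (hasHeight_cantorDegrees i) (f v))
    (a := n) (j := j + 1) (by lia)
  rw [pow_succ'] at hzx hwindow
  have hpos := Nat.two_pow_pos j
  have hp : ((f v).take (z + 2 ^ j)).1.length = z + 2 ^ j := by
    rw [SST.val_take, List.length_take]
    lia
  have hpv : ((f v).take (z + 2 ^ j)).1 <+: (f v).1 := List.take_prefix _ _
  have hpw := SST.prefix_map_of_prefix_map (w := w) (hasHeight_binaryTree k)
    (fun _ => isBranchLevel_binaryTree) hq hA hB hAB (by exact_mod_cast hj) hwindow hp
    hpv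
  have := wordDist_add_two_mul_length_le hpv hpw
  lia

theorem dist_map_le_of_embedding (hA : LipschitzWith A f) (hB : AntilipschitzWith B f)
    (hq : q ≤ k) (hAB : 2 * ((A * B : ℝ≥0) * (2 * q + 1) : ℝ) + 2 < 2 ^ q)
    (hj : (A : ℝ) * (2 * q + 1) < 2 ^ j) (v w : BinaryTree k) :
    dist (f v) (f w) ≤ 5 * i * 2 ^ (j + 1) := by
  obtain ⟨l, x, y, hv, hw, hd⟩ := exists_wordDist_eq (f v).1 (f w).1
  have hv' := congrArg List.length hv
  have hw' := congrArg List.length hw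
  rw [List.length_append] at hv' hw'
  have hx := length_lt_of_embedding hA hB hq hAB hj hv' hw' hd
  have hy := length_lt_of_embedding hA hB hq hAB hj hw' hv' (by rw [wordDist_comm, hd, add_comm])
  have hvi := SST.length_le_of_hasHeight (hasHeight_cantorDegrees i) (f v)
  have hwi := SST.length_le_of_hasHeight (hasHeight_cantorDegrees i) (f w)
  have hij : 2 * height i ≤ 5 * i * 2 ^ (j + 1) ∨
      2 * (height (j + 1) + 2 * 2 ^ (j + 1)) ≤ 5 * i * 2 ^ (j + 1) := by
    rcases le_or_gt i (j + 1) with h | h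
    · left
      rw [two_mul_height]
      gcongr <;> lia
    · right
      calc 2 * (height (j + 1) + 2 * 2 ^ (j + 1)) = (j + 1 + 4) * 2 ^ (j + 1) := by
            rw [mul_add, two_mul_height]
            ring
        _ ≤ 5 * i * 2 ^ (j + 1) := by
            gcongr
            lia
  rw [SST.dist_eq]
  exact_mod_cast (by lia : wordDist (f v).1 (f w).1 ≤ 5 * i * 2 ^ (j + 1))

theorem depth_le_of_embedding (hA : LipschitzWith A f) (hB : AntilipschitzWith B f)
    (hk : 0 < k) (hq : q ≤ k) (hAB : 2 * ((A * B : ℝ≥0) * (2 * q + 1) : ℝ) + 2 < 2 ^ q) :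
    (k : ℝ) ≤ 20 * (A * B : ℝ≥0) * (2 * q + 1) * i := by
  have hs := hasHeight_binaryTree k
  have hA1 : 1 ≤ (A : ℝ) := by
    have hdist := SST.dist_root_leftmost hs (n := 1) hk
    have hne := dist_pos.1 (hdist.trans_gt (by simp))
    simpa [hdist] using (SST.one_le_dist (hB.injective.ne hne)).trans (hA.dist_le_mul _ _)
  obtain ⟨n, hn, hn'⟩ := exists_nat_pow_near
    (one_le_mul_of_one_le_of_one_le hA1 (by simp : (1 : ℝ) ≤ 2 * q + 1)) one_lt_two
  calc (k : ℝ) = dist (SST.root _) (SST.leftmost hs k le_rfl) :=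
        (SST.dist_root_leftmost hs le_rfl).symm
    _ ≤ B * (5 * i * 2 ^ (n + 1 + 1)) := (hB.le_mul_dist _ _).trans <| by
        gcongr
        exact dist_map_le_of_embedding hA hB hq hAB hn' _ _
    _ = B * (5 * i * (4 * 2 ^ n)) := by ring
    _ ≤ B * (5 * i * (4 * (A * (2 * q + 1)))) := by gcongr
    _ = 20 * (A * B : ℝ≥0) * (2 * q + 1) * i := by
        push_cast
        ring

end Embedding

theorem depth_le_mul_height {k i : ℕ} {B : ℝ≥0} {f : BinaryTree k → Cantor i}
    (hB : AntilipschitzWith B f) : (k : ℝ) ≤ B * (2 * height i) := by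
  have hs := hasHeight_binaryTree k
  have hlen (v : Cantor i) : (v.1.length : ℝ) ≤ height i := by
    exact_mod_cast SST.length_le_of_hasHeight (hasHeight_cantorDegrees i) v
  calc (k : ℝ) = dist (SST.root _) (SST.leftmost hs k le_rfl) :=
        (SST.dist_root_leftmost hs le_rfl).symm
    _ ≤ B * dist (f (SST.root _)) (f (SST.leftmost hs k le_rfl)) := hB.le_mul_dist _ _
    _ ≤ B * (height i + height i) := by
        gcongr
        exact (SST.dist_le_length_add_length _ _).trans (add_le_add (hlen _) (hlen _))
    _ = B * (2 * height i) := by ring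

theorem exists_binaryDepth_cantor_le (c : ℝ) :
    ∃ K : ℕ, ∀ i : ℕ, binaryDepth (Cantor i) c ≤ ((K * i : ℕ) : ℕ∞) := by
  obtain ⟨q, hq⟩ := exists_lt_two_pow c.toNNReal
  obtain ⟨M, hM⟩ := exists_nat_ge (20 * (c.toNNReal : ℝ) * (2 * q + 1))
  refine ⟨M + q, fun i => iSup₂_le fun k hk => ?_⟩
  simp only [distortion, iInf_lt_iff] at hk
  obtain ⟨f, hf, hfc⟩ := hk
  obtain ⟨A, B, hAB, hA, hB⟩ := exists_lipschitzWith_antilipschitzWith hf hfc.ne_top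
  rw [← hAB, ENNReal.ofReal] at hfc
  have hABc : A * B ≤ c.toNNReal := by exact_mod_cast hfc.le
  rw [Nat.cast_le]
  rcases Nat.eq_zero_or_pos i with rfl | hi
  · simpa [height] using depth_le_mul_height hB
  rcases Nat.eq_zero_or_pos k with rfl | hk
  · exact Nat.zero_le _
  rcases lt_or_ge k q with hkq | hqk
  · nlinarith
  have hkM : (k : ℝ) ≤ M * i := by
    refine (depth_le_of_embedding hA hB hk hqk (lt_of_le_of_lt ?_ hq)).trans ?_
    · gcongr
    · refine le_trans ?_ (mul_le_mul_of_nonneg_right hM (Nat.cast_nonneg i))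
      gcongr
  calc k ≤ M * i := by exact_mod_cast hkM
    _ ≤ (M + q) * i := by gcongr; lia

/-! ### Lists of branching levels -/

/-- The differences of consecutive elements of a list. -/
def gaps (l : List ℕ) : List ℝ := List.zipWith (fun a b : ℕ => (b : ℝ) - a) l l.tail

theorem gaps_append {l l' : List ℕ} {a b : ℕ} (ha : l.getLast? = some a)
    (hb : l'.head? = some b) : gaps (l ++ l') = gaps l ++ ((b : ℝ) - a) :: gaps l' := by
  obtain ⟨l₀, rfl⟩ := List.getLast?_eq_some_iff.1 ha
  obtain ⟨l₁, rfl⟩ := List.head?_eq_some_iff.1 hb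
  clear ha hb
  induction l₀ with
  | nil => simp [gaps]
  | cons c l₀ ih =>
    cases l₀ with
    | nil => simp [gaps]
    | cons d l₀ => simpa [gaps] using ih

theorem gaps_map_add (l : List ℕ) (n : ℕ) : gaps (l.map (n + ·)) = gaps l := by
  simp [gaps, ← List.map_tail, List.zipWith_map]

instance (s : List ℕ) (a : ℕ) : Decidable (IsBranchLevel s a) :=
  inferInstanceAs (Decidable (2 ≤ s.getD a 0))

/-- The branching levels of a degree sequence, in increasing order. -/
def branchLevels (s : List ℕ) : List ℕ := (List.range s.length).filter (IsBranchLevel s ·)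

theorem branchLevels_append (s s' : List ℕ) :
    branchLevels (s ++ s') = branchLevels s ++ (branchLevels s').map (s.length + ·) := by
  rw [branchLevels, List.length_append, List.range_add, List.filter_append, List.filter_map]
  congr 1
  · refine List.filter_congr fun j hj => ?_
    rw [decide_eq_decide, IsBranchLevel, List.getD_append _ _ _ _ (List.mem_range.1 hj)]
    rfl
  · congr 1
    refine List.filter_congr fun j _ => ?_
    simp [IsBranchLevel, List.getElem?_append_right]

theorem branchLevels_replicate_one (n : ℕ) : branchLevels (List.replicate n 1) = [] := by
  rw [branchLevels, List.filter_eq_nil_iff]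
  intro j hj
  rw [List.length_replicate, List.mem_range] at hj
  simp [IsBranchLevel, hj]

theorem branchLevels_cantorSeq_succ (i : ℕ) : branchLevels (cantorSeq (i + 1)) =
    branchLevels (cantorSeq i) ++ (branchLevels (cantorSeq i)).map (height i + 2 ^ i + ·) := by
  have hlen : (cantorSeq i ++ List.replicate (2 ^ i - 1) 1).length = height i + 2 ^ i := by
    have := Nat.two_pow_pos i
    rw [List.length_append, List.length_replicate, length_cantorSeq]
    omega
  rw [cantorSeq, branchLevels_append, hlen, branchLevels_append, branchLevels_replicate_one,
    List.map_nil, List.append_nil]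

theorem branchLevels_cantorSeq (i : ℕ) : branchLevels (cantorSeq i) =
    (List.range (height i + 1)).filter (IsBranchLevel (cantorDegrees i) ·) ++ [height i] := by
  rw [branchLevels, length_cantorSeq, List.range_succ, List.filter_append, List.filter_append,
    List.filter_cons_of_pos (by simpa using isBranchLevel_height i),
    List.filter_cons_of_neg (by simp [isBranchLevel_cantorDegrees_iff]), List.filter_nil,
    List.filter_nil, List.append_nil]
  congr 1
  refine List.filter_congr fun j hj => ?_
  simp [isBranchLevel_cantorDegrees_iff, List.mem_range.1 hj]

theorem head?_branchLevels_cantorSeq (i : ℕ) : (branchLevels (cantorSeq i)).head? = some 0 := by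
  rw [branchLevels, length_cantorSeq, List.range_succ_eq_map,
    List.filter_cons_of_pos (by simpa using isBranchLevel_zero i), List.head?_cons]

theorem getLast?_branchLevels_cantorSeq (i : ℕ) :
    (branchLevels (cantorSeq i)).getLast? = some (height i) := by
  rw [branchLevels_cantorSeq, List.getLast?_concat]

theorem gaps_branchLevels_cantorSeq_succ (i : ℕ) : gaps (branchLevels (cantorSeq (i + 1))) =
    gaps (branchLevels (cantorSeq i)) ++ (2 ^ i : ℝ) :: gaps (branchLevels (cantorSeq i)) := by
  have hhead : ((branchLevels (cantorSeq i)).map (height i + 2 ^ i + ·)).head? =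
      some (height i + 2 ^ i) := by
    rw [List.head?_map, head?_branchLevels_cantorSeq, Option.map_some, add_zero]
  rw [branchLevels_cantorSeq_succ, gaps_append (getLast?_branchLevels_cantorSeq i) hhead,
    gaps_map_add, Nat.cast_add, add_sub_cancel_left, Nat.cast_pow, Nat.cast_ofNat]

theorem gaps_branchLevels_cantorSeq_zero : gaps (branchLevels (cantorSeq 0)) = [] := by
  simp [branchLevels, cantorSeq, gaps, IsBranchLevel]

theorem sum_gaps_branchLevels_cantorSeq (i : ℕ) :
    (gaps (branchLevels (cantorSeq i))).sum = height i := by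
  induction i with
  | zero => simp [gaps_branchLevels_cantorSeq_zero, height]
  | succ i ih =>
    rw [gaps_branchLevels_cantorSeq_succ, List.sum_append, List.sum_cons, ih, height]
    push_cast
    ring

theorem gaps_zero_cons_branchLevels_cantorSeq (i : ℕ) :
    gaps (0 :: branchLevels (cantorSeq i)) = 0 :: gaps (branchLevels (cantorSeq i)) := by
  simpa [gaps] using gaps_append (l := [0]) rfl (head?_branchLevels_cantorSeq i)

/- The gap `2 ^ k` occurs `2 ^ (i - 1 - k)` times for each `k < i`, so that every scale contributes
`2 ^ (i - 1)`. -/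
theorem le_sum_filter_gaps_cantorSeq {n : ℕ} {θ : ℝ} (hθ : (2 : ℝ) ^ n ≤ θ) (i : ℕ) :
    (min i (n + 1) : ℕ) * (2 : ℝ) ^ i ≤
      2 * ((gaps (branchLevels (cantorSeq i))).filter (· ≤ θ)).sum := by
  induction i with
  | zero => simp [gaps_branchLevels_cantorSeq_zero]
  | succ i ih =>
    have : (0 : ℝ) < 2 ^ i := by positivity
    rw [gaps_branchLevels_cantorSeq_succ, List.filter_append, List.sum_append, List.filter_cons,
      pow_succ]
    rcases Nat.lt_or_ge n i with hni | hin
    · rw [min_eq_right (by omega)] at ih ⊢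
      split_ifs <;> (try rw [List.sum_cons]) <;> nlinarith
    · have hgap : (2 : ℝ) ^ i ≤ θ := (pow_le_pow_right₀ (by norm_num) hin).trans hθ
      rw [min_eq_left (by omega)] at ih ⊢
      rw [if_pos (by simpa using hgap), List.sum_cons]
      push_cast
      nlinarith

/- Gaps of length at most `2 ^ (i / 2)` already make up half of the height `i * 2 ^ (i - 1)`, while
the threshold `2 ^ (-i / 3) * height i` exceeds `2 ^ (2 * i / 3)`. -/
theorem isWeakPath_gaps_cantorSeq {i : ℕ} (hi : 2 ≤ i) :
    IsWeakPath (1 / 2) ((2 : ℝ) ^ (-(i : ℝ) / 3)) (gaps (0 :: branchLevels (cantorSeq i))) := by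
  set δ := (2 : ℝ) ^ (-(i : ℝ) / 3)
  have hheight : 2 * (height i : ℝ) = i * 2 ^ i := mod_cast two_mul_height i
  obtain ⟨n, hin, hni⟩ : ∃ n : ℕ, i ≤ 2 * (n + 1) ∧ 2 * n ≤ i := ⟨i / 2, by omega, by omega⟩
  have hpow : (2 : ℝ) ^ i ≤ height i := by
    have : (2 : ℝ) ≤ i := mod_cast hi
    have : (0 : ℝ) < 2 ^ i := by positivity
    nlinarith
  have hthreshold : (2 : ℝ) ^ n ≤ δ * height i := by
    have : (2 : ℝ) * n ≤ i := mod_cast hni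
    calc (2 : ℝ) ^ n = 2 ^ (n : ℝ) := (Real.rpow_natCast 2 n).symm
      _ ≤ 2 ^ (-(i : ℝ) / 3 + i) := Real.rpow_le_rpow_of_exponent_le (by norm_num) (by linarith)
      _ = δ * 2 ^ i := by rw [Real.rpow_add (by norm_num), Real.rpow_natCast]
      _ ≤ δ * height i := by gcongr
  have hpos : 0 ≤ δ * height i := by positivity
  have hshort := le_sum_filter_gaps_cantorSeq hthreshold i
  have hmin : (i : ℝ) ≤ 2 * (min i (n + 1) : ℕ) :=
    mod_cast (by omega : i ≤ 2 * min i (n + 1))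
  rw [IsWeakPath, gaps_zero_cons_branchLevels_cantorSeq, List.sum_cons, zero_add,
    sum_gaps_branchLevels_cantorSeq, List.filter_cons_of_pos (by simpa using hpos),
    List.sum_cons, zero_add]
  have : (0 : ℝ) < 2 ^ i := by positivity
  nlinarith

/-! ### Weak prototypes -/

theorem pathDist_one {V : Type*} {G : SimpleGraph V} (hG : G.Connected) (u v : V) :
    pathDist G (fun _ => 1) u v = G.dist u v := by
  have hlength (w : G.Walk u v) : (w.edges.map fun _ => (1 : ℝ)).sum = w.length := by simp
  simp only [pathDist, hlength]
  obtain ⟨w, hw⟩ := hG.exists_walk_length_eq_dist u v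
  have : Nonempty (G.Walk u v) := ⟨w⟩
  refine le_antisymm ((ciInf_le ⟨0, ?_⟩ w).trans_eq (by rw [hw])) (le_ciInf fun w' => ?_)
  · rintro _ ⟨w', rfl⟩
    positivity
  · exact_mod_cast SimpleGraph.dist_le w'

namespace SST

variable {s : List ℕ}

theorem exists_walk_support_eq_map_take (v : SST s) {n : ℕ} (hn : n ≤ v.1.length) :
    ∃ P : (graph s).Walk (root s) (v.take n), P.support = (List.range (n + 1)).map v.take := by
  induction n with
  | zero => exact ⟨SimpleGraph.Walk.nil, rfl⟩
  | succ n ih =>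
    obtain ⟨P, hP⟩ := ih (by omega)
    refine ⟨P.concat (v.adj_take_take hn), ?_⟩
    rw [SimpleGraph.Walk.support_concat, hP, List.range_succ (n := n + 1), List.map_append,
      List.map_singleton]

theorem support_eq_map_take {v : SST s} {P : (graph s).Walk (root s) v} (hP : P.IsPath) :
    P.support = (List.range (v.1.length + 1)).map v.take := by
  obtain ⟨Q, hQ⟩ : ∃ Q : (graph s).Walk (root s) v,
      Q.support = (List.range (v.1.length + 1)).map v.take := by
    have hwalk := v.exists_walk_support_eq_map_take le_rfl
    rwa [take_length] at hwalk
  have hlength := congrArg List.length hQ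
  rw [SimpleGraph.Walk.length_support, List.length_map, List.length_range,
    ← graph_dist_root] at hlength
  have hQpath : Q.IsPath := Q.isPath_of_length_eq_dist (by omega)
  rw [(isTree.existsUnique_path _ _).unique hP hQpath, hQ]

theorem branchList_eq_map_take {v : SST s} {P : (graph s).Walk (root s) v} (hP : P.IsPath) :
    branchList (graph s) (root s) P = (0 :: ((List.range (v.1.length + 1)).filter
      (IsBranchLevel s ·) ++ [v.1.length])).map v.take := by
  classical
  rw [branchList, support_eq_map_take hP, List.filter_map, List.cons_append, List.map_cons,
    List.map_append, List.map_singleton, take_length]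
  congr 3
  refine List.filter_congr fun j hj => ?_
  have hlen : (v.take j).1.length = j := by
    have := List.mem_range.1 hj
    rw [val_take, List.length_take]
    omega
  rw [Function.comp_apply, encard_children, hlen, decide_eq_decide, IsBranchLevel]
  exact_mod_cast Iff.rfl

theorem pathDist_take_take (v : SST s) {m n : ℕ} (hmn : m ≤ n) (hn : n ≤ v.1.length) :
    pathDist (graph s) (fun _ => 1) (v.take m) (v.take n) = (n : ℝ) - m := by
  have hpre : (v.take m).1 <+: (v.take n).1 := List.take_prefix_take_left hmn
  rw [pathDist_one (connected s), graph_dist_eq, wordDist_of_isPrefix hpre, val_take, val_take,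
    List.length_take_of_le hn, List.length_take_of_le (hmn.trans hn), Nat.cast_sub hmn]

theorem zipWith_pathDist_map_take (v : SST s) {l : List ℕ} (hl : l.SortedLE)
    (hlv : ∀ n ∈ l, n ≤ v.1.length) :
    List.zipWith (pathDist (graph s) fun _ => 1) (l.map v.take) (l.map v.take).tail = gaps l := by
  rw [gaps, ← List.map_tail, List.zipWith_map]
  refine List.ext_getElem (by simp) fun j _ hj => ?_
  rw [List.length_zipWith, List.length_tail, lt_min_iff] at hj
  simp only [List.getElem_zipWith, List.getElem_tail]
  exact v.pathDist_take_take (hl.getElem_le_getElem_of_le (by omega))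
    (hlv _ (List.getElem_mem _))

end SST

theorem isDegreeTwoWeak_cantor {i : ℕ} (hi : 2 ≤ i) {v : Cantor i}
    (hv : v.1.length = height i)
    {P : (SST.graph (cantorDegrees i)).Walk (SST.root (cantorDegrees i)) v} (hP : P.IsPath) :
    IsDegreeTwoWeak (SST.graph (cantorDegrees i)) (SST.root (cantorDegrees i)) (fun _ => 1)
      (1 / 2) ((2 : ℝ) ^ (-(i : ℝ) / 3)) P := by
  have hsorted : (0 :: branchLevels (cantorSeq i)).SortedLE :=
    List.Pairwise.sortedLE <| List.pairwise_cons.2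
      ⟨fun _ _ => Nat.zero_le _, List.pairwise_le_range.filter _⟩
  have hbound : ∀ n ∈ 0 :: branchLevels (cantorSeq i), n ≤ v.1.length := by
    simp only [branchLevels, length_cantorSeq, hv, List.mem_cons, List.mem_filter, List.mem_range]
    omega
  rw [IsDegreeTwoWeak, SST.branchList_eq_map_take hP, hv, ← branchLevels_cantorSeq,
    SST.zipWith_pathDist_map_take v hsorted hbound]
  exact isWeakPath_gaps_cantorSeq hi

theorem isWeakPrototype_cantor {i : ℕ} (hi : 2 ≤ i) :
    IsWeakPrototype (SST.graph (cantorDegrees i)) (SST.root (cantorDegrees i)) (fun _ => 1)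
      (1 / 2) ((2 : ℝ) ^ (-(i : ℝ) / 3)) 1 where
  isTree := SST.isTree
  length_pos _ _ := one_pos
  one_or_two_children v hv := by
    rw [SST.isLeaf_iff] at hv
    rw [SST.encard_children]
    have := getD_cantorDegrees_le_two i v.1.length
    norm_cast
    omega
  root_leaf_weak v _ hv hP :=
    isDegreeTwoWeak_cantor hi ((SST.isLeaf_iff_length_eq (hasHeight_cantorDegrees i) v).1 hv) hP
  height_ratio v w hv hw := by
    rw [SST.isLeaf_iff_length_eq (hasHeight_cantorDegrees i)] at hv hw
    rw [one_mul, pathDist_one (SST.connected _), pathDist_one (SST.connected _),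
      SST.graph_dist_root, SST.graph_dist_root, hv, hw]

/-! ### Distortion, Markov convexity and binary depth -/

theorem min_one_div_one_half {p : ℝ} (hp : 0 < p) : min (1 / p) (1 / 2) = 1 / max 2 p := by
  rcases le_total 2 p with h | h
  · rw [max_eq_right h, min_eq_left (one_div_le_one_div_of_le two_pos h)]
  · rw [max_eq_left h, min_eq_right (one_div_le_one_div_of_le hp h)]

theorem exists_binaryDepth_cantor_le_mul (c : ℝ) : ∃ K : ℝ≥0, ∀ i : ℕ,
    (binaryDepth (Cantor i) c : ℝ≥0∞) ≤ (K : ℝ≥0∞) * i := by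
  obtain ⟨K, hK⟩ := exists_binaryDepth_cantor_le c
  exact ⟨K, fun i => by simpa using ENat.toENNReal_le.2 (hK i)⟩

theorem exists_mul_rpow_le_mul_rpow (K : ℝ≥0) {a : ℝ≥0} (ha : 0 < a) : ∃ κ : ℝ≥0, 0 < κ ∧
    ∀ θ : ℝ, 0 ≤ θ → θ ≤ 1 → ∀ x y : ℝ≥0∞, x ≤ K * y → (κ : ℝ≥0∞) * x ^ θ ≤ (a * y) ^ θ := by
  obtain ⟨κ, hκ₀, hκ₁, hκK⟩ : ∃ κ > 0, κ ≤ 1 ∧ κ * K ≤ a := by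
    refine ⟨a / (K + a), by positivity, div_le_one_of_le₀ le_add_self zero_le, ?_⟩
    rw [div_mul_comm]
    exact mul_le_of_le_one_left zero_le (div_le_one_of_le₀ le_self_add zero_le)
  refine ⟨κ, hκ₀, fun θ hθ₀ hθ₁ x y hxy => ?_⟩
  have hκθ : (κ : ℝ≥0∞) ≤ (κ : ℝ≥0∞) ^ θ := by
    simpa using ENNReal.rpow_le_rpow_of_exponent_ge (ENNReal.coe_le_one_iff.2 hκ₁) hθ₁
  have hκx : (κ : ℝ≥0∞) * x ≤ a * y :=
    calc (κ : ℝ≥0∞) * x ≤ κ * (K * y) := by gcongr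
      _ = ((κ * K : ℝ≥0) : ℝ≥0∞) * y := by rw [ENNReal.coe_mul, mul_assoc]
      _ ≤ a * y := by gcongr
  calc (κ : ℝ≥0∞) * x ^ θ ≤ (κ : ℝ≥0∞) ^ θ * x ^ θ := by gcongr
    _ = (κ * x) ^ θ := (ENNReal.mul_rpow_of_nonneg _ _ hθ₀).symm
    _ ≤ (a * y) ^ θ := by gcongr

theorem exists_mul_binaryDepth_rpow_le_markovConvexity (c : ℝ) : ∃ κ : ℝ≥0, 0 < κ ∧
    ∀ p : ℝ, 0 < p → ∀ i : ℕ,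
      (κ : ℝ≥0∞) * (binaryDepth (Cantor i) c : ℝ≥0∞) ^ (min (1 / p) (1 / 2)) ≤
        markovConvexity (max 2 p) (Cantor i) := by
  obtain ⟨K, hK⟩ := exists_binaryDepth_cantor_le_mul c
  obtain ⟨κ, hκ, hle⟩ := exists_mul_rpow_le_mul_rpow K (a := 1 / 8) (by norm_num)
  refine ⟨κ, hκ, fun p hp i => ?_⟩
  have hexp : min (1 / p) (1 / 2) ≤ 1 := (min_le_right _ _).trans (by norm_num)
  refine (hle _ (by positivity) hexp _ _ (hK i)).trans ?_
  rw [min_one_div_one_half hp]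
  exact le_markovConvexity_cantor (lt_max_of_lt_left two_pos) i

theorem exists_mul_binaryDepth_rpow_le_lpDistortion {p : ℝ} (hp : 1 < p) (c : ℝ) :
    ∃ κ : ℝ≥0, 0 < κ ∧ ∀ i : ℕ,
      (κ : ℝ≥0∞) * (binaryDepth (Cantor i) c : ℝ≥0∞) ^ (min (1 / p) (1 / 2)) ≤
        lpDistortion p (Cantor i) := by
  obtain ⟨κ, hκ, hlp⟩ := exists_mul_markovConvexity_le_lpDistortion hp
  obtain ⟨κ', hκ', hdepth⟩ := exists_mul_binaryDepth_rpow_le_markovConvexity c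
  refine ⟨κ * κ', mul_pos hκ hκ', fun i => ?_⟩
  rw [ENNReal.coe_mul, mul_assoc]
  exact (mul_le_mul_right (hdepth p (by linarith) i) _).trans (hlp (Cantor i))

open Filter Asymptotics in
theorem exists_le_add_mul_of_isLittleO {f g : ℕ → ℝ} (hf : 0 ≤ f) (hg : g =o[atTop] f) {ε : ℝ}
    (hε : 0 < ε) : ∃ M, ∀ k, g k ≤ M + ε * f k := by
  have hevent : ∀ᶠ k in atTop, g k - ε * f k ≤ 0 := by
    filter_upwards [hg.def hε] with k hk
    rw [Real.norm_of_nonneg (hf k)] at hk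
    linarith [Real.le_norm_self (g k)]
  obtain ⟨M, hM⟩ := (isBoundedUnder_of_eventually_le hevent).bddAbove_range
  exact ⟨M, fun k => by linarith [hM (Set.mem_range_self k)]⟩

open Filter Asymptotics in
theorem eventually_lt_mul_rpow_of_isLittleO {g : ℕ → ℝ} {θ : ℝ} (hθ : 0 < θ)
    (hg : g =o[atTop] fun k : ℕ => (k : ℝ) ^ θ) {d : ℕ → ℕ} {K : ℕ} (hd : ∀ i, d i ≤ K * i)
    {η : ℝ} (hη : 0 < η) : ∀ᶠ i : ℕ in atTop, g (d i) < η * (i : ℝ) ^ θ := by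
  obtain ⟨ε, hε, hεK⟩ : ∃ ε > 0, ε * (K : ℝ) ^ θ ≤ η / 2 := by
    refine ⟨η / 2 / ((K : ℝ) ^ θ + 1), by positivity, ?_⟩
    rw [div_mul_comm]
    exact mul_le_of_le_one_left (by positivity) (div_le_one_of_le₀ (by linarith) (by positivity))
  obtain ⟨M, hM⟩ := exists_le_add_mul_of_isLittleO (fun k => by positivity) hg hε
  have htendsto : Tendsto (fun i : ℕ => η / 2 * (i : ℝ) ^ θ) atTop atTop :=
    ((tendsto_rpow_atTop hθ).comp tendsto_natCast_atTop_atTop).const_mul_atTop (by positivity)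
  filter_upwards [htendsto.eventually_gt_atTop M] with i hi
  have hdi : (d i : ℝ) ^ θ ≤ (K : ℝ) ^ θ * (i : ℝ) ^ θ := by
    rw [← Real.mul_rpow (Nat.cast_nonneg _) (Nat.cast_nonneg _)]
    have : (d i : ℝ) ≤ K * i := mod_cast hd i
    gcongr
  calc g (d i) ≤ M + ε * (d i : ℝ) ^ θ := hM (d i)
    _ ≤ M + ε * ((K : ℝ) ^ θ * (i : ℝ) ^ θ) := by gcongr
    _ = M + ε * (K : ℝ) ^ θ * (i : ℝ) ^ θ := by ring
    _ ≤ M + η / 2 * (i : ℝ) ^ θ := by gcongr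
    _ < η / 2 * (i : ℝ) ^ θ + η / 2 * (i : ℝ) ^ θ := by gcongr
    _ = η * (i : ℝ) ^ θ := by ring

open Filter Asymptotics in
theorem exists_ofReal_lt_lpDistortion {p : ℝ} (hp : 1 < p) (c : ℝ) {g : ℕ → ℝ}
    (hg : g =o[atTop] (fun k : ℕ => (k : ℝ) ^ (min (1 / p) (1 / 2)))) :
    ∃ i k : ℕ, binaryDepth (Cantor i) c = k ∧
      ENNReal.ofReal (g k) < lpDistortion p (Cantor i) := by
  have hq : 0 < max 2 p := lt_max_of_lt_left two_pos
  rw [min_one_div_one_half (by linarith)] at hg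
  set θ := 1 / max 2 p
  have hθ : 0 < θ := by positivity
  obtain ⟨κ, hκ, hlp⟩ := exists_mul_markovConvexity_le_lpDistortion hp
  obtain ⟨K, hK⟩ := exists_binaryDepth_cantor_le c
  have hfinite (i : ℕ) : ∃ d : ℕ, d = binaryDepth (Cantor i) c :=
    ENat.ne_top_iff_exists.1 (ne_top_of_le_ne_top (ENat.natCast_ne_top _) (hK i))
  choose d hd using hfinite
  have hdK (i : ℕ) : d i ≤ K * i := by exact_mod_cast (hd i).trans_le (hK i)
  have hη : 0 < (κ : ℝ) * (1 / 8) ^ θ := by positivity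
  obtain ⟨i, hgi, hi⟩ := ((eventually_lt_mul_rpow_of_isLittleO hθ hg hdK hη).and
    (eventually_gt_atTop 0)).exists
  refine ⟨i, d i, (hd i).symm, ?_⟩
  rw [mul_assoc, ← Real.mul_rpow (by norm_num) (Nat.cast_nonneg i)] at hgi
  calc ENNReal.ofReal (g (d i)) < ENNReal.ofReal (κ * (1 / 8 * i) ^ θ) :=
        (ENNReal.ofReal_lt_ofReal_iff (by positivity)).2 hgi
    _ = κ * (((1 / 8 : ℝ≥0) : ℝ≥0∞) * i) ^ θ := by
        rw [ENNReal.ofReal_mul κ.coe_nonneg, ENNReal.ofReal_coe_nnreal,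
          ← ENNReal.ofReal_rpow_of_nonneg (by positivity) hθ.le, ENNReal.ofReal_mul (by norm_num),
          ENNReal.ofReal_natCast, ← ENNReal.ofReal_coe_nnreal (p := 1 / 8)]
        simp
    _ ≤ κ * markovConvexity (max 2 p) (Cantor i) :=
        mul_le_mul_right (le_markovConvexity_cantor hq i) _
    _ ≤ lpDistortion p (Cantor i) := hlp (Cantor i)

end CantorTree

end

open CantorTree Filter Asymptotics in
theorem claim3 :
    -- the trees grow
    Tendsto (fun i => Nat.card (Cantor i)) atTop atTop ∧
    -- they are weak prototypes (unit edge lengths, height ratio one)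
    (∀ i : ℕ, 2 ≤ i →
      IsWeakPrototype (SST.graph (cantorDegrees i)) (SST.root (cantorDegrees i)) (fun _ => 1)
        (1 / 2) ((2 : ℝ) ^ (-(i : ℝ) / 3)) 1) ∧
    -- their Markov convexity constants are at least of order `i ^ (1 / p)`
    (∃ κ : ℝ≥0, 0 < κ ∧ ∀ p : ℝ, 0 < p → ∀ i : ℕ,
      ((κ : ℝ≥0∞) * i) ^ (1 / p) ≤ markovConvexity p (Cantor i)) ∧
    -- they contain only binary trees of depth `O(i)`
    (∀ c : ℝ, 1 < c → ∃ K : ℝ≥0, ∀ i : ℕ,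
      (binaryDepth (Cantor i) c : ℝ≥0∞) ≤ (K : ℝ≥0∞) * i) ∧
    -- the chain of inequalities between distortion, Markov convexity and binary depth
    (∀ p : ℝ, 1 < p → ∃ κ : ℝ≥0, 0 < κ ∧ ∀ i : ℕ,
      (κ : ℝ≥0∞) * markovConvexity (max 2 p) (Cantor i) ≤ lpDistortion p (Cantor i)) ∧
    (∀ c : ℝ, 1 < c → ∃ κ : ℝ≥0, 0 < κ ∧ ∀ p : ℝ, 1 < p → ∀ i : ℕ,
      (κ : ℝ≥0∞) * (binaryDepth (Cantor i) c : ℝ≥0∞) ^ (min (1 / p) (1 / 2)) ≤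
        markovConvexity (max 2 p) (Cantor i)) ∧
    (∀ p : ℝ, 1 < p → ∀ c : ℝ, 1 < c → ∃ κ : ℝ≥0, 0 < κ ∧ ∀ i : ℕ,
      (κ : ℝ≥0∞) * (binaryDepth (Cantor i) c : ℝ≥0∞) ^ (min (1 / p) (1 / 2)) ≤
        lpDistortion p (Cantor i)) ∧
    -- no upper bound on the distortion by a function of the binary depth of smaller order holds
    (∀ p : ℝ, 1 < p → ∀ c : ℝ, 1 < c → ∀ g : ℕ → ℝ,
      g =o[atTop] (fun k : ℕ => (k : ℝ) ^ (min (1 / p) (1 / 2))) →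
      ∃ i k : ℕ, binaryDepth (Cantor i) c = k ∧
        ENNReal.ofReal (g k) < lpDistortion p (Cantor i)) := by
  refine ⟨tendsto_card_cantor, fun _ hi => isWeakPrototype_cantor hi,
    ⟨1 / 8, by norm_num, fun _ hp i => le_markovConvexity_cantor hp i⟩,
    fun c _ => exists_binaryDepth_cantor_le_mul c, fun p hp => ?_, fun c _ => ?_,
    fun p hp c _ => exists_mul_binaryDepth_rpow_le_lpDistortion hp c,
    fun p hp c _ g hg => exists_ofReal_lt_lpDistortion hp c hg⟩
  · obtain ⟨κ, hκ, h⟩ := exists_mul_markovConvexity_le_lpDistortion hp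
    exact ⟨κ, hκ, fun i => h (Cantor i)⟩
  · obtain ⟨κ, hκ, h⟩ := exists_mul_binaryDepth_rpow_le_markovConvexity c
    exact ⟨κ, hκ, fun p hp => h p (zero_lt_one.trans hp)⟩
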